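/- Let $d \ge 1$ be an integer and let $\mathbb{Z}^d$ be the grid graph, in which two points are joined by an edge iff their $\ell^1$-distance is $1$. A \emph{gossip matrix} on this graph is a matrix $(W_{v,w})_{v,w\in\mathbb{Z}^d}$ that is nonnegative, symmetric, stochastic ($\sum_w W_{v,w}=1$ for all $v$) and supported by the graph ($W_{v,w}>0$ and $v\ne w$ imply that $\{v,w\}$ is an edge). A \emph{polynomial gossip method} on $\mathbb{Z}^d$ is a method of the form $x^t = P_t(W)\xi$, $t \ge 0$, where $W$ is a gossip matrix on $\mathbb{Z}^d$ and $P_t$ is a real polynomial with $\deg P_t\le t$ and $P_t(1)=1$. Let $\nu$ be a probability law on $\mathbb{R}$ with finite, nonzero variance and mean $\mu$, and let $\xi_w$, $w\in\mathbb{Z}^d$, be i.i.d. random variables with law $\nu$. Let $W = A(\mathbb{Z}^d)/(2d)$, where $A(\mathbb{Z}^d)$ is the adjacency matrix, and let $x^t$ be the iterates of the Jacobi polynomial iteration with parameter $d$, $$x^0=\xi,\qquad x^1 = a_0 W\xi + b_0\xi,\qquad x^{t+1} = a_t W x^t + b_t x^t - c_t x^{t-1}\quad (t\ge 1),$$ where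 $$a_0=\frac{d+4}{2(2+d)},\qquad b_0=\frac{d}{2(2+d)},$$ and, for $t\ge 1$, $$a_t=\frac{(2t+d/2+1)(2t+d/2+2)}{2(t+1+d/2)^2},\quad b_t=\frac{d^2(2t+d/2+1)}{8(t+1+d/2)^2(2t+d/2)},\quad c_t=\frac{t^2(2t+d/2+2)}{(t+1+d/2)^2(2t+d/2)}.$$ Then, for every vertex $v\in\mathbb{Z}^d$, $$\lim_{t\to\infty}\frac{\ln \mathbb{E}[(x^t_v-\mu)^2]}{\ln t} = -d .$$ This rate is optimal: the Jacobi polynomial iteration is a polynomial gossip method on $\mathbb{Z}^d$, and every polynomial gossip method $y^t=P_t(W')\xi$ on $\mathbb{Z}^d$ satisfies $$\liminf_{t\to\infty}\frac{\ln \mathbb{E}[(y^t_v-\mu)^2]}{\ln t} \ge -d .$$ -/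

import Mathlib

namespace Gossip

/-- The grid `ℤ^d`: two points are joined by an edge iff their `ℓ¹` distance is `1`. -/
def gridGraph (d : ℕ) : SimpleGraph (Fin d → ℤ) where
  Adj u v := ∑ i, |u i - v i| = 1
  symm := ⟨fun u v h => by
    have h' : ∑ i, |u i - v i| = 1 := h
    show ∑ i, |v i - u i| = 1
    rw [← h']
    exact Finset.sum_congr rfl fun i _ => abs_sub_comm _ _⟩
  loopless := ⟨fun u h => by simp at h⟩

instance (d : ℕ) : DecidableRel (gridGraph d).Adj :=
  fun u v => inferInstanceAs (Decidable (∑ i, |u i - v i| = 1))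

/-- Gossip matrices on a (locally finite) graph: nonnegative, supported by the graph
(diagonal entries are allowed), stochastic and symmetric. -/
structure IsGossipMatrix {V : Type*} (G : SimpleGraph V) (W : Matrix V V ℝ) : Prop where
  nonneg : ∀ v w, 0 ≤ W v w
  supported : ∀ v w, v ≠ w → 0 < W v w → G.Adj v w
  stochastic : ∀ v, HasSum (fun w => W v w) 1
  symmetric : ∀ v w, W v w = W w v

/-- The gossip matrix of the simple random walk on `ℤ^d`, which is a `2d`-regular graph. -/
noncomputable def gridMatrix (d : ℕ) : Matrix (Fin d → ℤ) (Fin d → ℤ) ℝ :=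
  (2 * (d : ℝ))⁻¹ • (gridGraph d).adjMatrix ℝ

/-- The product `W x` for a matrix with finitely many nonzero entries in each row. -/
noncomputable def act {V : Type*} (W : Matrix V V ℝ) (x : V → ℝ) : V → ℝ :=
  fun v => ∑ᶠ w, W v w * x w

/-- The product `P(W) ξ`, that is `∑ᵢ pᵢ Wⁱ ξ` where `P = ∑ᵢ pᵢ Xⁱ`. -/
noncomputable def polyAct {V : Type*} (P : Polynomial ℝ) (W : Matrix V V ℝ) (ξ : V → ℝ) :
    V → ℝ :=
  P.sum fun i p => p • (act W)^[i] ξ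

/-- A method, sending the initial observations `ξ` to the iterates `x⁰, x¹, …`, is a polynomial
gossip method on `G` if `xᵗ = Pₜ(W) ξ` for a gossip matrix `W` on `G` and polynomials `Pₜ` with
`deg Pₜ ≤ t` and `Pₜ(1) = 1`. -/
def IsPolynomialGossip {V : Type*} (G : SimpleGraph V) (x : (V → ℝ) → ℕ → V → ℝ) : Prop :=
  ∃ (W : Matrix V V ℝ) (P : ℕ → Polynomial ℝ), IsGossipMatrix G W ∧
    (∀ t, (P t).natDegree ≤ t ∧ (P t).eval 1 = 1) ∧
    ∀ ξ t, x ξ t = polyAct (P t) W ξ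

/-- The weights `a_t` of the Jacobi polynomial iteration with parameter `d`. -/
noncomputable def jacobiA (d : ℝ) : ℕ → ℝ
  | 0 => (d + 4) / (2 * (2 + d))
  | t@(_ + 1) => (2 * t + d / 2 + 1) * (2 * t + d / 2 + 2) / (2 * (t + 1 + d / 2) ^ 2)

/-- The weights `b_t` of the Jacobi polynomial iteration with parameter `d`. -/
noncomputable def jacobiB (d : ℝ) : ℕ → ℝ
  | 0 => d / (2 * (2 + d))
  | t@(_ + 1) => d ^ 2 * (2 * t + d / 2 + 1) / (8 * (t + 1 + d / 2) ^ 2 * (2 * t + d / 2))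

/-- The weights `c_t` of the Jacobi polynomial iteration with parameter `d`
(only used for `t ≥ 1`). -/
noncomputable def jacobiC (d : ℝ) (t : ℕ) : ℝ :=
  (t : ℝ) ^ 2 * (2 * t + d / 2 + 2) / ((t + 1 + d / 2) ^ 2 * (2 * t + d / 2))

/-- The Jacobi polynomial iteration with parameter `d`, gossip matrix `W` and initial
observations `ξ`. -/
noncomputable def jacobiIteration {V : Type*} (d : ℝ) (W : Matrix V V ℝ) (ξ : V → ℝ) :
    ℕ → V → ℝ
  | 0 => ξ
  | 1 => jacobiA d 0 • act W ξ + jacobiB d 0 • ξ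
  | t + 2 =>
      jacobiA d (t + 1) • act W (jacobiIteration d W ξ (t + 1))
        + jacobiB d (t + 1) • jacobiIteration d W ξ (t + 1)
        - jacobiC d (t + 1) • jacobiIteration d W ξ t

end Gossip

/-! The error at `v` is the variance of `ν` times the squared ℓ² norm of the row of `P_t(W)` at `v`.
Both bounds are estimates of that norm.

Lower bound, for every method: the row sums to 1 and lives on at most `(2t+1)^d` points, so by
Cauchy–Schwarz its squared norm is at least `(2t+1)^(-d)` (`IsPolynomialGossip.variance_le`).

Upper bound: `W` is a convolution, so Parseval (`integral_sq_eval_symbol`) turns the norm into the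
integral of `P_t(σ(p))²` over the torus, `σ` being the average of the cosines of the frequencies.
Here `P_t` is the Jacobi polynomial with parameters `(d/2, 0)`, normalized at 1. Its differential
equation yields an energy argument showing that `(t√(1-x²))^(d+1) P_t(x)²` is bounded
(`jacobiPoly_decay`). The power `d+1` need not be integrable against the spectral measure, but
interpolation with `P_t² ≤ 1` gives every exponent `κ < d`. By AM–GM (`prod_abs_sin_rpow_le`),
`(1-σ²)^(-κ/2)` is at most a product of one-dimensional functions `|sin|^(-κ/d)`, which are
integrable. The norm is thus `O(t^(-κ))` for each `κ < d`, enough on a logarithmic scale. -/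

namespace Gossip

/-! ### Jacobi polynomials: recurrence, first-order relations, differential equation -/

/-- The normalized Jacobi polynomials: the polynomials `P_t` of the Jacobi iteration. -/
noncomputable def jacobiPoly (d : ℝ) : ℕ → Polynomial ℝ
  | 0 => 1
  | 1 => Polynomial.C (jacobiA d 0) * Polynomial.X + Polynomial.C (jacobiB d 0)
  | t + 2 =>
      Polynomial.C (jacobiA d (t + 1)) * (Polynomial.X * jacobiPoly d (t + 1))
        + Polynomial.C (jacobiB d (t + 1)) * jacobiPoly d (t + 1)
        - Polynomial.C (jacobiC d (t + 1)) * jacobiPoly d t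

open Polynomial in
lemma natDegree_jacobiPoly_le (d : ℝ) (t : ℕ) : (jacobiPoly d t).natDegree ≤ t := by
  induction t using Nat.twoStepInduction with
  | zero => simp [jacobiPoly]
  | one => rw [jacobiPoly]; exact natDegree_linear_le
  | more t ih ih' =>
    rw [jacobiPoly]
    compute_degree
    omega

lemma eval_jacobiPoly_add_two (d : ℝ) (t : ℕ) (x : ℝ) :
    (jacobiPoly d (t + 2)).eval x =
      (jacobiA d (t + 1) * x + jacobiB d (t + 1)) * (jacobiPoly d (t + 1)).eval x
        - jacobiC d (t + 1) * (jacobiPoly d t).eval x := by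
  simp only [jacobiPoly, Polynomial.eval_sub, Polynomial.eval_add, Polynomial.eval_mul,
    Polynomial.eval_C, Polynomial.eval_X]
  ring

lemma eval_derivative_jacobiPoly_add_two (d : ℝ) (t : ℕ) (x : ℝ) :
    (jacobiPoly d (t + 2)).derivative.eval x =
      jacobiA d (t + 1) * (jacobiPoly d (t + 1)).eval x
        + (jacobiA d (t + 1) * x + jacobiB d (t + 1)) * (jacobiPoly d (t + 1)).derivative.eval x
        - jacobiC d (t + 1) * (jacobiPoly d t).derivative.eval x := by
  simp only [jacobiPoly, Polynomial.derivative_sub, Polynomial.derivative_add,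
    Polynomial.derivative_mul, Polynomial.derivative_X,
    Polynomial.derivative_C, Polynomial.eval_sub, Polynomial.eval_add, Polynomial.eval_mul,
    Polynomial.eval_C, Polynomial.eval_X, Polynomial.eval_one, Polynomial.eval_zero]
  ring

/-- The two classical first-order relations between consecutive Jacobi polynomials. -/
lemma jacobiPoly_structure {d : ℝ} (hd : 0 < d) (t : ℕ) (x : ℝ) :
    (2 * (t + 1) + d / 2) * (1 - x ^ 2) * (jacobiPoly d (t + 1)).derivative.eval x =
        (t + 1) * (d / 2 - (2 * (t + 1) + d / 2) * x) * (jacobiPoly d (t + 1)).eval x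
          + 2 * (t + 1) ^ 2 * (jacobiPoly d t).eval x ∧
      (2 * t + d / 2 + 2) * (1 - x ^ 2) * (jacobiPoly d t).derivative.eval x =
        (t + d / 2 + 1) * ((d / 2 + (2 * t + d / 2 + 2) * x) * (jacobiPoly d t).eval x
          - 2 * (t + d / 2 + 1) * (jacobiPoly d (t + 1)).eval x) := by
  induction t with
  | zero =>
    have h1 : (2 + d) ≠ 0 := by positivity
    simp only [jacobiPoly, jacobiA, jacobiB, Polynomial.derivative_add,
      Polynomial.derivative_C_mul, Polynomial.derivative_X, Polynomial.derivative_C,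
      Polynomial.derivative_one, Polynomial.eval_add, Polynomial.eval_mul, Polynomial.eval_C,
      Polynomial.eval_X, Polynomial.eval_one, Polynomial.eval_zero]
    constructor <;> (push_cast; field_simp; ring)
  | succ t ih =>
    obtain ⟨hA, hB⟩ := ih
    have h0 : (0 : ℝ) ≤ t := t.cast_nonneg
    have e1 : (2 * ((t : ℝ) + 1) + d / 2) ≠ 0 := by positivity
    have e2 : ((t : ℝ) + 1 + 1 + d / 2) ≠ 0 := by positivity
    have e3 : (2 * (t : ℝ) + d / 2 + 2) ≠ 0 := by positivity
    have hA' : (1 - x ^ 2) * (jacobiPoly d (t + 1)).derivative.eval x =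
        ((t + 1) * (d / 2 - (2 * (t + 1) + d / 2) * x) * (jacobiPoly d (t + 1)).eval x
          + 2 * (t + 1) ^ 2 * (jacobiPoly d t).eval x) / (2 * (t + 1) + d / 2) := by
      rw [eq_div_iff e1]; linarith
    have hB' : (1 - x ^ 2) * (jacobiPoly d t).derivative.eval x =
        ((t + d / 2 + 1) * ((d / 2 + (2 * t + d / 2 + 2) * x) * (jacobiPoly d t).eval x
          - 2 * (t + d / 2 + 1) * (jacobiPoly d (t + 1)).eval x)) / (2 * t + d / 2 + 2) := by
      rw [eq_div_iff e3]; linarith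
    have hD := eval_derivative_jacobiPoly_add_two d t x
    have hE := eval_jacobiPoly_add_two d t x
    -- After multiplication by `1 - x²`, the two inductive relations remove all derivatives from the
    -- differentiated recurrence. Both are needed: one for the derivative of `P_{t+1}`, the other
    -- for that of `P_t`.
    have hD' : (1 - x ^ 2) * (jacobiPoly d (t + 2)).derivative.eval x =
      jacobiA d (t + 1) * (1 - x ^ 2) * (jacobiPoly d (t + 1)).eval x
        + (jacobiA d (t + 1) * x + jacobiB d (t + 1)) *
          ((1 - x ^ 2) * (jacobiPoly d (t + 1)).derivative.eval x)
        - jacobiC d (t + 1) * ((1 - x ^ 2) * (jacobiPoly d t).derivative.eval x) := by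
      rw [hD]; ring
    rw [hA', hB'] at hD'
    rw [mul_assoc, show t + 1 + 1 = t + 2 from rfl, hD', mul_assoc (2 * ((t + 1 : ℕ) : ℝ) + d / 2 + 2),
      hA', hE]
    simp only [jacobiA, jacobiB, jacobiC]
    push_cast
    generalize Polynomial.eval x (jacobiPoly d (t + 1)) = p
    generalize Polynomial.eval x (jacobiPoly d t) = q
    constructor
    · field_simp
      ring
    · field_simp
      ring

/-- The Jacobi differential equation with parameters `(d / 2, 0)`. -/
lemma jacobiPoly_ode {d : ℝ} (hd : 0 < d) (t : ℕ) {x : ℝ} (hx : 1 - x ^ 2 ≠ 0) :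
    (1 - x ^ 2) * (jacobiPoly d t).derivative.derivative.eval x =
      (d / 2 + (d / 2 + 2) * x) * (jacobiPoly d t).derivative.eval x
        - t * (t + d / 2 + 1) * (jacobiPoly d t).eval x := by
  cases t with
  | zero => simp [jacobiPoly]
  | succ t =>
    obtain ⟨hA, hB⟩ := jacobiPoly_structure hd t x
    have h0 : (0 : ℝ) ≤ t := t.cast_nonneg
    have e1 : (2 * ((t : ℝ) + 1) + d / 2) ≠ 0 := by positivity
    -- The first relation is restated between polynomials so that it can be differentiated. The
    -- second relation then eliminates the derivative of `P_t`, and the first eliminates `P_t`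
    -- itself.
    have hP : Polynomial.C (2 * (t + 1) + d / 2) *
        ((1 - Polynomial.X ^ 2) * (jacobiPoly d (t + 1)).derivative) =
        Polynomial.C ((t : ℝ) + 1) * ((Polynomial.C (d / 2) -
          Polynomial.C (2 * (t + 1) + d / 2) * Polynomial.X) * jacobiPoly d (t + 1))
          + Polynomial.C (2 * ((t : ℝ) + 1) ^ 2) * jacobiPoly d t := by
      refine Polynomial.funext fun z => ?_
      have := (jacobiPoly_structure hd t z).1
      simp only [Polynomial.eval_mul, Polynomial.eval_add, Polynomial.eval_sub, Polynomial.eval_C,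
        Polynomial.eval_X, Polynomial.eval_one, Polynomial.eval_pow]
      linear_combination this
    have hQ := congrArg (fun p => (Polynomial.derivative p).eval x) hP
    simp only [Polynomial.derivative_mul, Polynomial.derivative_add,
      Polynomial.derivative_sub, Polynomial.derivative_X, Polynomial.derivative_C,
      Polynomial.derivative_one, Polynomial.derivative_X_pow, Polynomial.eval_mul,
      Polynomial.eval_add, Polynomial.eval_sub, Polynomial.eval_C, Polynomial.eval_X,
      Polynomial.eval_one, Polynomial.eval_pow, Polynomial.eval_zero] at hQ
    push_cast
    refine mul_left_cancel₀ (mul_ne_zero (mul_ne_zero e1 e1) hx) ?_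
    push_cast at hQ
    simp only [pow_one] at hQ
    generalize Polynomial.eval x (jacobiPoly d (t + 1)) = p at *
    generalize Polynomial.eval x (jacobiPoly d t) = q at *
    generalize Polynomial.eval x (jacobiPoly d (t + 1)).derivative = p' at *
    generalize Polynomial.eval x (jacobiPoly d t).derivative = q' at *
    generalize Polynomial.eval x (jacobiPoly d (t + 1)).derivative.derivative = p'' at *
    linear_combination (2 * (t + 1) + d / 2) * (1 - x ^ 2) * hQ + 2 * (t + 1) ^ 2 * hB
      - (t + 1 + d / 2) * (d / 2 + (2 * (t + 1) + d / 2) * x) * hA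

end Gossip

/-! ### Uniform bounds on [-1, 1] -/

namespace Gossip

lemma eval_one_jacobiPoly {d : ℝ} (hd : 0 < d) (t : ℕ) : (jacobiPoly d t).eval 1 = 1 := by
  induction t using Nat.twoStepInduction with
  | zero => simp [jacobiPoly]
  | one =>
    simp only [jacobiPoly, jacobiA, jacobiB, Polynomial.eval_add, Polynomial.eval_mul,
      Polynomial.eval_C, Polynomial.eval_X]
    field_simp
    ring
  | more t ih ih' =>
    have h0 : (0 : ℝ) ≤ t := t.cast_nonneg
    have e1 : (2 * ((t : ℝ) + 1) + d / 2) ≠ 0 := by positivity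
    have e2 : ((t : ℝ) + 1 + 1 + d / 2) ≠ 0 := by positivity
    rw [eval_jacobiPoly_add_two, ih, ih']
    simp only [jacobiA, jacobiB, jacobiC]
    push_cast
    field_simp
    ring

/-- At `x = -1` the derivative drops out of the first relation, leaving `P_{t+1}(-1) =
-(t+1)/(t+1+d/2) · P_t(-1)`, a contraction. -/
lemma sq_eval_neg_one_jacobiPoly_le {d : ℝ} (hd : 0 < d) (t : ℕ) :
    (jacobiPoly d t).eval (-1) ^ 2 ≤ 1 := by
  induction t with
  | zero => simp [jacobiPoly]
  | succ t ih =>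
    have h0 : (0 : ℝ) ≤ t := t.cast_nonneg
    have hA := (jacobiPoly_structure hd t (-1)).1
    have h1 : ((t : ℝ) + 1 + d / 2) * (jacobiPoly d (t + 1)).eval (-1) =
        -((t + 1) * (jacobiPoly d t).eval (-1)) := by
      have : (2 * ((t : ℝ) + 1)) ≠ 0 := by positivity
      refine mul_left_cancel₀ this ?_
      linear_combination -hA
    rw [sq_le_one_iff_abs_le_one] at ih ⊢
    have h2 := congrArg abs h1
    rw [abs_mul, abs_neg, abs_mul, abs_of_pos (by positivity : (0 : ℝ) < (t : ℝ) + 1 + d / 2),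
      abs_of_pos (by positivity : (0 : ℝ) < (t : ℝ) + 1)] at h2
    have h3 : 0 < (t : ℝ) + 1 + d / 2 := by positivity
    refine le_of_mul_le_mul_left ?_ h3
    rw [h2, mul_one]
    nlinarith

/-- Sonine's bound: the quadratic form `N y² + (1 - x²) y'²` attains its maximum over `[-1, 1]`
at an end point. -/
lemma jacobiPoly_sonine {d : ℝ} (hd : 0 < d) (t : ℕ) {x : ℝ} (hx : x ∈ Set.Icc (-1 : ℝ) 1) :
    t * (t + d / 2 + 1) * (jacobiPoly d t).eval x ^ 2
      + (1 - x ^ 2) * (jacobiPoly d t).derivative.eval x ^ 2 ≤ t * (t + d / 2 + 1) := by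
  set P := jacobiPoly d t with hP
  set N : ℝ := t * (t + d / 2 + 1) with hN
  have hN0 : 0 ≤ N := by positivity
  set f : ℝ → ℝ := fun x => N * P.eval x ^ 2 + (1 - x ^ 2) * P.derivative.eval x ^ 2 with hf
  have hder : ∀ z, HasDerivAt f (N * (2 * P.eval z * P.derivative.eval z)
      + ((-(2 * z)) * P.derivative.eval z ^ 2
        + (1 - z ^ 2) * (2 * P.derivative.eval z * P.derivative.derivative.eval z))) z := by
    intro z
    have h1 := ((P.hasDerivAt z).pow 2).const_mul N
    have h2 := (((hasDerivAt_id z).pow 2).const_sub 1).mul ((P.derivative.hasDerivAt z).pow 2)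
    refine (h1.add h2).congr_deriv ?_
    simp
  have hder' : ∀ z ∈ Set.Ioo (-1 : ℝ) 1,
      deriv f z = 2 * (d / 2 + (d / 2 + 1) * z) * P.derivative.eval z ^ 2 := by
    intro z hz
    rw [(hder z).deriv]
    have := jacobiPoly_ode hd t (x := z) (by nlinarith [hz.1, hz.2])
    linear_combination 2 * P.derivative.eval z * this
  have hcont : Continuous f := by
    rw [hf]; fun_prop
  -- The only sign change of the linear factor in `f'`: `f` decreases before `x₀` and increases
  -- after it, so its maximum is at an end point, where the term in `P'²` vanishes.
  set x₀ : ℝ := -(d / 2) / (d / 2 + 1) with hx₀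
  have hd1 : 0 < d / 2 + 1 := by positivity
  have hx₀1 : -1 < x₀ := by rw [hx₀, lt_div_iff₀ hd1]; linarith
  have hx₀2 : x₀ < 1 := by rw [hx₀, div_lt_iff₀ hd1]; linarith
  have hx₀3 : (d / 2 + 1) * x₀ = -(d / 2) := by rw [hx₀]; field_simp
  show f x ≤ N
  rcases le_total x₀ x with h | h
  · have hm : MonotoneOn f (Set.Icc x₀ 1) := by
      refine monotoneOn_of_deriv_nonneg (convex_Icc _ _) hcont.continuousOn
        (fun z _ => (hder z).differentiableAt.differentiableWithinAt) fun z hz => ?_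
      rw [interior_Icc] at hz
      rw [hder' z ⟨hx₀1.trans hz.1, hz.2⟩]
      have : 0 ≤ d / 2 + (d / 2 + 1) * z := by nlinarith [hz.1]
      positivity
    refine (hm ⟨h, hx.2⟩ ⟨hx₀2.le, le_rfl⟩ hx.2).trans (le_of_eq ?_)
    simp [hf, hP, eval_one_jacobiPoly hd]
  · have hm : AntitoneOn f (Set.Icc (-1) x₀) := by
      refine antitoneOn_of_deriv_nonpos (convex_Icc _ _) hcont.continuousOn
        (fun z _ => (hder z).differentiableAt.differentiableWithinAt) fun z hz => ?_
      rw [interior_Icc] at hz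
      rw [hder' z ⟨hz.1, hz.2.trans hx₀2⟩]
      have : d / 2 + (d / 2 + 1) * z ≤ 0 := by nlinarith [hz.2]
      have h2 := sq_nonneg (P.derivative.eval z)
      nlinarith
    refine (hm ⟨le_rfl, hx₀1.le⟩ ⟨hx.1, h⟩ hx.1).trans ?_
    have := sq_eval_neg_one_jacobiPoly_le hd t
    simp only [hf, hP]
    nlinarith

lemma sq_eval_jacobiPoly_le_one {d : ℝ} (hd : 0 < d) (t : ℕ) {x : ℝ}
    (hx : x ∈ Set.Icc (-1 : ℝ) 1) : (jacobiPoly d t).eval x ^ 2 ≤ 1 := by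
  rcases Nat.eq_zero_or_pos t with rfl | ht
  · simp [jacobiPoly]
  · have h := jacobiPoly_sonine hd t hx
    have hx2 : 0 ≤ 1 - x ^ 2 := by nlinarith [hx.1, hx.2]
    have hN : (0 : ℝ) < t * (t + d / 2 + 1) := by positivity
    refine le_of_mul_le_mul_left ?_ hN
    nlinarith [mul_nonneg hx2 (sq_nonneg ((jacobiPoly d t).derivative.eval x))]

end Gossip

/-! ### Liouville normal form and its energy -/

namespace Gossip
open Real

/-- The damping coefficient of the Jacobi equation in the variable `τ`, where `x = cos 2τ`. -/
noncomputable def damping (d : ℝ) (τ : ℝ) : ℝ :=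
  (d + 1) / 2 * (cos τ / sin τ) - 1 / 2 * (sin τ / cos τ)

/-- The potential of the Jacobi equation in Liouville normal form, in the variable `τ`. -/
noncomputable def potential (d n : ℝ) (τ : ℝ) : ℝ :=
  (2 * n + d / 2 + 1) ^ 2 - (d ^ 2 - 1) / 4 / sin τ ^ 2 + 1 / 4 / cos τ ^ 2

/-- This is where the potential comes from. With `k` the damping and `w = sin^(d+1) cos`, so that
`w' = 2kw`, the function `u = √w Y` satisfies `u'' + Φu = 0` for `Φ = 4n(n+d/2+1) - k' - k²`. -/
lemma hasDerivAt_damping (d n : ℝ) {τ : ℝ} (hs : sin τ ≠ 0) (hc : cos τ ≠ 0) :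
    HasDerivAt (damping d)
      (4 * (n * (n + d / 2 + 1)) - potential d n τ - damping d τ ^ 2) τ := by
  have h1 := (((hasDerivAt_cos τ).div (hasDerivAt_sin τ) hs).const_mul ((d + 1) / 2)).sub
    (((hasDerivAt_sin τ).div (hasDerivAt_cos τ) hc).const_mul (1 / 2))
  refine h1.congr_deriv ?_
  have h := sin_sq_add_cos_sq τ
  simp only [damping, potential]
  field_simp
  generalize sin τ = s at *
  generalize cos τ = c at *
  have hc2 : c ^ 2 = 1 - s ^ 2 := by linarith
  simp only [hc2]
  ring

lemma hasDerivAt_potential (d n : ℝ) {τ : ℝ} (hs : sin τ ≠ 0) (hc : cos τ ≠ 0) :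
    HasDerivAt (potential d n)
      ((d ^ 2 - 1) / 2 * cos τ / sin τ ^ 3 + 1 / 2 * sin τ / cos τ ^ 3) τ := by
  have h1 := ((((hasDerivAt_sin τ).pow 2).inv (pow_ne_zero 2 hs)).const_mul
    ((d ^ 2 - 1) / 4)).const_sub ((2 * n + d / 2 + 1) ^ 2)
  have h2 := (((hasDerivAt_cos τ).pow 2).inv (pow_ne_zero 2 hc)).const_mul (1 / 4 : ℝ)
  refine ((h1.add h2).congr_deriv ?_).congr_of_eventuallyEq ?_
  · simp only [Pi.pow_apply]
    field_simp
    ring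
  · exact Filter.Eventually.of_forall fun z => by simp [potential, div_eq_mul_inv]

/-- The energy of a solution `Y`, with derivative `Z`, of the Jacobi equation. -/
noncomputable def jacobiEnergy (d : ℕ) (n : ℝ) (Y Z : ℝ → ℝ) (τ : ℝ) : ℝ :=
  sin τ ^ (d + 1) * cos τ * (Y τ ^ 2 + (Z τ + damping d τ * Y τ) ^ 2 / potential d n τ)

/-- The energy is `u² + u'²/Φ` with `u = √w Y` and `u' = √w (Z + kY)`. Since `u'' = -Φu`, only the
term `-u'² Φ'/Φ²` survives, so the energy decreases wherever `Φ` increases. -/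
lemma hasDerivAt_jacobiEnergy (d : ℕ) (n : ℝ) {Y Z : ℝ → ℝ} {τ : ℝ} (hs : sin τ ≠ 0)
    (hc : cos τ ≠ 0) (hΦ : potential d n τ ≠ 0) (hY : HasDerivAt Y (Z τ) τ)
    (hZ : HasDerivAt Z (-2 * damping d τ * Z τ - 4 * (n * (n + d / 2 + 1)) * Y τ) τ) :
    HasDerivAt (jacobiEnergy d n Y Z)
      (-(sin τ ^ (d + 1) * cos τ * (Z τ + damping d τ * Y τ) ^ 2 / potential d n τ ^ 2 *
        (((d : ℝ) ^ 2 - 1) / 2 * cos τ / sin τ ^ 3 + 1 / 2 * sin τ / cos τ ^ 3))) τ := by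
  have hk := hasDerivAt_damping d n hs hc
  have hp := hasDerivAt_potential d n hs hc
  have hw : HasDerivAt (fun τ => sin τ ^ (d + 1) * cos τ)
      (2 * damping d τ * (sin τ ^ (d + 1) * cos τ)) τ := by
    refine (((hasDerivAt_sin τ).pow (d + 1)).mul (hasDerivAt_cos τ)).congr_deriv ?_
    simp only [damping, Pi.pow_apply]
    push_cast
    field_simp
    ring
  have hV := (((hZ.add (hk.mul hY)).pow 2).div hp hΦ)
  refine (hw.mul ((hY.pow 2).add hV)).congr_deriv ?_
  simp only [Pi.pow_apply, Pi.add_apply, Pi.mul_apply, Pi.div_apply]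
  push_cast
  generalize ((d : ℝ) ^ 2 - 1) / 2 * cos τ / sin τ ^ 3 + 1 / 2 * sin τ / cos τ ^ 3 = q
  generalize sin τ ^ (d + 1) * cos τ = w
  generalize potential d n τ = p at *
  generalize damping d τ = k at *
  field_simp
  ring

end Gossip

/-! ### The pointwise envelope -/

namespace Gossip
open Real

lemma cos_two_mul_mem_Icc (τ : ℝ) : cos (2 * τ) ∈ Set.Icc (-1 : ℝ) 1 :=
  ⟨neg_one_le_cos _, cos_le_one _⟩

lemma hasDerivAt_jacobiPoly_cos (d : ℝ) (n : ℕ) (τ : ℝ) :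
    HasDerivAt (fun τ => (jacobiPoly d n).eval (cos (2 * τ)))
      (-2 * sin (2 * τ) * (jacobiPoly d n).derivative.eval (cos (2 * τ))) τ := by
  have h : HasDerivAt (fun τ : ℝ => cos (2 * τ)) (-sin (2 * τ) * (2 * 1)) τ :=
    ((hasDerivAt_id τ).const_mul 2).cos
  refine (((jacobiPoly d n).hasDerivAt (cos (2 * τ))).comp τ h).congr_deriv ?_
  ring

/-- The Jacobi equation in the variable `τ`, where `x = cos 2τ`. -/
lemma hasDerivAt_derivative_jacobiPoly_cos {d : ℝ} (hd : 0 < d) (n : ℕ) {τ : ℝ}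
    (hs : sin τ ≠ 0) (hc : cos τ ≠ 0) :
    HasDerivAt (fun τ => -2 * sin (2 * τ) * (jacobiPoly d n).derivative.eval (cos (2 * τ)))
      (-2 * damping d τ * (-2 * sin (2 * τ) * (jacobiPoly d n).derivative.eval (cos (2 * τ)))
        - 4 * ((n : ℝ) * (n + d / 2 + 1)) * (jacobiPoly d n).eval (cos (2 * τ))) τ := by
  have h : HasDerivAt (fun τ : ℝ => cos (2 * τ)) (-sin (2 * τ) * (2 * 1)) τ :=
    ((hasDerivAt_id τ).const_mul 2).cos
  have h' : HasDerivAt (fun τ : ℝ => sin (2 * τ)) (cos (2 * τ) * (2 * 1)) τ :=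
    ((hasDerivAt_id τ).const_mul 2).sin
  refine ((h'.const_mul (-2)).mul
    (((jacobiPoly d n).derivative.hasDerivAt (cos (2 * τ))).comp τ h)).congr_deriv ?_
  have hsc : 1 - cos (2 * τ) ^ 2 = sin (2 * τ) ^ 2 := by
    linarith [sin_sq_add_cos_sq (2 * τ)]
  have hsin : sin (2 * τ) ≠ 0 := by
    rw [sin_two_mul]; exact mul_ne_zero (mul_ne_zero two_ne_zero hs) hc
  have hode := jacobiPoly_ode hd n (x := cos (2 * τ)) (by rw [hsc]; exact pow_ne_zero 2 hsin)
  have hk : damping d τ * sin (2 * τ) = d / 2 + (d / 2 + 1) * cos (2 * τ) := by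
    have := sin_sq_add_cos_sq τ
    rw [damping, sin_two_mul, cos_two_mul]
    field_simp
    linear_combination (-2 : ℝ) * this
  rw [hsc] at hode
  simp only [Function.comp]
  linear_combination 4 * hode
    + 4 * (jacobiPoly d n).derivative.eval (cos (2 * τ)) * (-hk)

lemma potential_lower_bound (d n : ℕ) {τ : ℝ} (hc : cos τ ≠ 0)
    (hs : ((d : ℝ) + 1) / (n + (d / 2 + 1) / 2) ≤ sin τ) :
    2 * ((n : ℝ) + (d / 2 + 1) / 2) ^ 2 ≤ potential d n τ := by
  set M : ℝ := (n : ℝ) + (d / 2 + 1) / 2 with hM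
  have hM0 : 0 < M := by positivity
  have hs0 : 0 < sin τ := lt_of_lt_of_le (by positivity) hs
  have h1 : (d : ℝ) + 1 ≤ sin τ * M := by rwa [div_le_iff₀ hM0] at hs
  have h2 : ((d : ℝ) ^ 2 - 1) / 4 / sin τ ^ 2 ≤ M ^ 2 := by
    rw [div_le_iff₀ (by positivity)]
    have : ((d : ℝ) + 1) ^ 2 ≤ (sin τ * M) ^ 2 := by gcongr
    nlinarith [(d.cast_nonneg : (0 : ℝ) ≤ d)]
  have h3 : 0 ≤ 1 / 4 / cos τ ^ 2 := by positivity
  have h4 : (2 * (n : ℝ) + d / 2 + 1) ^ 2 = 4 * M ^ 2 := by rw [hM]; ring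
  rw [potential, h4]
  nlinarith [sq_nonneg M]

/-- At the matching angle the cotangent term is exactly `M cos τ / 2`, the tangent is at most 1, and
the cross term of the square has a favourable sign. -/
lemma sq_damping_le (d : ℕ) {M τ : ℝ} (hM : sin τ * M = d + 1) (hs : 0 < sin τ)
    (hs' : sin τ ≤ 1 / 2) (hc : 0 < cos τ) : damping d τ ^ 2 ≤ M ^ 2 / 4 + 1 / 4 := by
  have h1 := sin_sq_add_cos_sq τ
  have h2 : (((d : ℝ) + 1) / 2 * (cos τ / sin τ)) ^ 2 ≤ M ^ 2 / 4 := by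
    have : ((d : ℝ) + 1) / 2 * (cos τ / sin τ) = M / 2 * cos τ := by
      rw [← hM]; field_simp
    rw [this]
    nlinarith [cos_sq_le_one τ, sq_nonneg M]
  have h3 : (1 / 2 * (sin τ / cos τ)) ^ 2 ≤ 1 / 4 := by
    have : sin τ ^ 2 / cos τ ^ 2 ≤ 1 := by
      rw [div_le_one (by positivity)]
      nlinarith
    rw [mul_pow, div_pow (sin τ)]
    linarith
  have h4 : 0 ≤ (((d : ℝ) + 1) / 2 * (cos τ / sin τ)) * (1 / 2 * (sin τ / cos τ)) := by
    positivity
  rw [damping, sub_sq]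
  linarith

/-- The envelope of the Jacobi polynomials with parameters `(d / 2, 0)`. -/
lemma jacobiPoly_cos_decay {d n : ℕ} (hd : 1 ≤ d) (hn : 2 * (d + 1) ≤ n) {τ : ℝ}
    (hτ : τ ∈ Set.Ioo 0 (π / 2)) :
    (n * sin τ) ^ (d + 1) * cos τ * (jacobiPoly d n).eval (cos (2 * τ)) ^ 2
      ≤ 7 * ((d : ℝ) + 1) ^ (d + 1) := by
  have hd0 : (0 : ℝ) < d := by exact_mod_cast hd
  have hd1 : (1 : ℝ) ≤ d := by exact_mod_cast hd
  have hn' : 2 * ((d : ℝ) + 1) ≤ n := by exact_mod_cast hn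
  set M : ℝ := (n : ℝ) + (d / 2 + 1) / 2 with hM
  have hM0 : 0 < M := by positivity
  have hnM : (n : ℝ) ≤ M := by rw [hM]; linarith
  set s₀ : ℝ := ((d : ℝ) + 1) / M with hs₀
  have hs₀0 : 0 < s₀ := by positivity
  have hs₀M : s₀ * M = d + 1 := by rw [hs₀]; field_simp
  have hs₀1 : s₀ ≤ 1 / 2 := by rw [hs₀, div_le_iff₀ hM0]; linarith
  have hcpos : ∀ z ∈ Set.Ioo 0 (π / 2), 0 < cos z := fun z hz =>
    cos_pos_of_mem_Ioo ⟨by linarith [hz.1, pi_pos], hz.2⟩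
  have hspos : ∀ z ∈ Set.Ioo 0 (π / 2), 0 < sin z := fun z hz =>
    sin_pos_of_pos_of_lt_pi hz.1 (by linarith [hz.2, pi_pos])
  have hc := hcpos τ hτ
  have hs := hspos τ hτ
  have hy := sq_eval_jacobiPoly_le_one hd0 n (cos_two_mul_mem_Icc τ)
  -- Below the scale `s₀`, of order `1/n`, the bound `P² ≤ 1` suffices. Beyond it the potential is
  -- at least `2M²`, and the energy carries the bound from `τ₀ = arcsin s₀` to `τ`.
  rcases le_total (sin τ) s₀ with h | h
  · have h1 : (n * sin τ) ≤ (d : ℝ) + 1 := by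
      rw [← hs₀M, mul_comm]
      exact mul_le_mul h hnM (by positivity) hs₀0.le
    calc (n * sin τ) ^ (d + 1) * cos τ * (jacobiPoly d n).eval (cos (2 * τ)) ^ 2
        ≤ ((d : ℝ) + 1) ^ (d + 1) * 1 * 1 := by
          gcongr
          exact cos_le_one τ
      _ ≤ 7 * ((d : ℝ) + 1) ^ (d + 1) := by
          have : 0 < ((d : ℝ) + 1) ^ (d + 1) := by positivity
          linarith
  set Y : ℝ → ℝ := fun τ => (jacobiPoly d n).eval (cos (2 * τ)) with hY
  set Z : ℝ → ℝ := fun τ => -2 * sin (2 * τ) * (jacobiPoly d n).derivative.eval (cos (2 * τ))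
    with hZ
  set τ₀ := arcsin s₀ with hτ₀
  have hsin₀ : sin τ₀ = s₀ := sin_arcsin (by linarith) (by linarith)
  have hτ₀0 : 0 < τ₀ := arcsin_pos.2 hs₀0
  have hτ₀τ : τ₀ ≤ τ := by
    rw [hτ₀, arcsin_le_iff_le_sin' ⟨by linarith [hτ.1, pi_pos], hτ.2⟩]
    exact h
  have hτ₀I : τ₀ ∈ Set.Ioo 0 (π / 2) := ⟨hτ₀0, hτ₀τ.trans_lt hτ.2⟩
  have hc₀ := hcpos τ₀ hτ₀I
  have hI : ∀ z ∈ Set.Icc τ₀ τ, z ∈ Set.Ioo 0 (π / 2) := fun z hz =>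
    ⟨hτ₀0.trans_le hz.1, hz.2.trans_lt hτ.2⟩
  have hΦ : ∀ z ∈ Set.Icc τ₀ τ, 2 * M ^ 2 ≤ potential d n z := fun z hz => by
    refine potential_lower_bound d n (hcpos z (hI z hz)).ne' ?_
    rw [← hM, ← hs₀, ← hsin₀]
    exact sin_le_sin_of_le_of_le_pi_div_two (by linarith [pi_pos]) (hI z hz).2.le hz.1
  have hder : ∀ z ∈ Set.Icc τ₀ τ, HasDerivAt (jacobiEnergy d n Y Z) _ z := fun z hz =>
    hasDerivAt_jacobiEnergy d n (hspos z (hI z hz)).ne' (hcpos z (hI z hz)).ne'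
      (lt_of_lt_of_le (by positivity) (hΦ z hz)).ne' (hasDerivAt_jacobiPoly_cos d n z)
      (hasDerivAt_derivative_jacobiPoly_cos hd0 n (hspos z (hI z hz)).ne' (hcpos z (hI z hz)).ne')
  have hanti : AntitoneOn (jacobiEnergy d n Y Z) (Set.Icc τ₀ τ) := by
    refine antitoneOn_of_deriv_nonpos (convex_Icc _ _)
      (fun z hz => (hder z hz).continuousAt.continuousWithinAt)
      (fun z hz => (hder z (interior_subset hz)).differentiableAt.differentiableWithinAt)
      fun z hz => ?_
    have hz' := interior_subset hz
    rw [(hder z hz').deriv]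
    have h1 := hcpos z (hI z hz')
    have h2 := hspos z (hI z hz')
    -- Here `d ≥ 1` matters: it makes both terms of `Φ'` nonnegative.
    have h3 : 0 ≤ (d : ℝ) ^ 2 - 1 := by nlinarith
    rw [neg_nonpos]
    positivity
  have hE := hanti ⟨le_rfl, hτ₀τ⟩ ⟨hτ₀τ, le_rfl⟩ hτ₀τ
  have hlow : sin τ ^ (d + 1) * cos τ * Y τ ^ 2 ≤ jacobiEnergy d n Y Z τ := by
    rw [jacobiEnergy]
    have := hΦ τ ⟨hτ₀τ, le_rfl⟩
    have h1 : 0 < potential d n τ := lt_of_lt_of_le (by positivity) this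
    gcongr
    exact le_add_of_nonneg_right (by positivity)
  have hZ0 : Z τ₀ ^ 2 ≤ 4 * M ^ 2 := by
    have h1 := jacobiPoly_sonine hd0 n (cos_two_mul_mem_Icc τ₀)
    have h2 : 1 - cos (2 * τ₀) ^ 2 = sin (2 * τ₀) ^ 2 := by
      linarith [sin_sq_add_cos_sq (2 * τ₀)]
    rw [h2] at h1
    have h3 : (n : ℝ) * (n + d / 2 + 1) ≤ M ^ 2 := by rw [hM]; nlinarith
    have h4 : 0 ≤ (n : ℝ) * (n + d / 2 + 1) * (jacobiPoly d n).eval (cos (2 * τ₀)) ^ 2 := by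
      positivity
    have h5 : Z τ₀ ^ 2 =
        4 * (sin (2 * τ₀) ^ 2 * (jacobiPoly d n).derivative.eval (cos (2 * τ₀)) ^ 2) := by
      simp only [hZ]; ring
    rw [h5]
    linarith
  have hY0 : Y τ₀ ^ 2 ≤ 1 := sq_eval_jacobiPoly_le_one hd0 n (cos_two_mul_mem_Icc τ₀)
  have hk0 : damping d τ₀ ^ 2 ≤ M ^ 2 / 4 + 1 / 4 :=
    sq_damping_le d (by rw [hsin₀, hs₀M]) (by rw [hsin₀]; exact hs₀0) (by rw [hsin₀]; exact hs₀1)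
      hc₀
  -- The constant is `7 = 1 + 6`: `Y² ≤ 1`, while `(Z + kY)² ≤ 2Z² + 2k²Y² ≤ 12M²` is divided by `Φ
  -- ≥ 2M²`.
  have hup : jacobiEnergy d n Y Z τ₀ ≤ 7 * s₀ ^ (d + 1) := by
    have h1 := hΦ τ₀ ⟨le_rfl, hτ₀τ⟩
    have hM1 : 1 ≤ M ^ 2 := by nlinarith
    have h2 : (Z τ₀ + damping d τ₀ * Y τ₀) ^ 2 ≤ 12 * M ^ 2 := by
      have h3 : damping d τ₀ ^ 2 * Y τ₀ ^ 2 ≤ M ^ 2 / 4 + 1 / 4 := by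
        refine le_trans ?_ hk0
        exact mul_le_of_le_one_right (sq_nonneg _) hY0
      nlinarith [sq_nonneg (Z τ₀ - damping d τ₀ * Y τ₀)]
    have h3 : (Z τ₀ + damping d τ₀ * Y τ₀) ^ 2 / potential d n τ₀ ≤ 6 := by
      rw [div_le_iff₀ (lt_of_lt_of_le (by positivity) h1)]
      linarith
    rw [jacobiEnergy, hsin₀]
    calc s₀ ^ (d + 1) * cos τ₀ *
          (Y τ₀ ^ 2 + (Z τ₀ + damping d τ₀ * Y τ₀) ^ 2 / potential d n τ₀)
        ≤ s₀ ^ (d + 1) * 1 * (1 + 6) := by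
          gcongr
          · have : 0 ≤ potential d n τ₀ := le_trans (by positivity) h1
            positivity
          · exact cos_le_one _
      _ = 7 * s₀ ^ (d + 1) := by ring
  calc (n * sin τ) ^ (d + 1) * cos τ * Y τ ^ 2
      = n ^ (d + 1) * (sin τ ^ (d + 1) * cos τ * Y τ ^ 2) := by ring
    _ ≤ M ^ (d + 1) * (7 * s₀ ^ (d + 1)) := by
        refine mul_le_mul (pow_le_pow_left₀ n.cast_nonneg hnM _) (hlow.trans (hE.trans hup)) ?_ ?_
          <;> positivity
    _ = 7 * ((d : ℝ) + 1) ^ (d + 1) := by rw [← hs₀M, mul_pow]; ring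

/-- With `x = cos 2τ`, one has `√(1-x²) = 2 sin τ cos τ`. Bounding `cos^(d+1)` by `cos` gives up
sharpness near `x = -1` for a form that is even in `x`. -/
lemma jacobiPoly_decay {d n : ℕ} (hd : 1 ≤ d) (hn : 2 * (d + 1) ≤ n) {x : ℝ}
    (hx : x ∈ Set.Ioo (-1 : ℝ) 1) :
    (n * √(1 - x ^ 2)) ^ (d + 1) * (jacobiPoly d n).eval x ^ 2
      ≤ 7 * (2 * ((d : ℝ) + 1)) ^ (d + 1) := by
  set τ := arccos x / 2 with hτ
  have h2 : 2 * τ = arccos x := by rw [hτ]; ring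
  have hτI : τ ∈ Set.Ioo 0 (π / 2) := by
    have h1 : 0 < arccos x := arccos_pos.2 hx.2
    have h3 : arccos x < π := lt_of_le_of_ne (arccos_le_pi x) fun h => by
      rw [arccos_eq_pi] at h; linarith [hx.1]
    constructor <;> linarith
  have hcos : cos (2 * τ) = x := by rw [h2, cos_arccos hx.1.le hx.2.le]
  have hsin : √(1 - x ^ 2) = 2 * sin τ * cos τ := by rw [← sin_arccos, ← h2, sin_two_mul]
  have h := jacobiPoly_cos_decay hd hn hτI
  rw [hcos] at h
  have hc : 0 ≤ cos τ := cos_nonneg_of_mem_Icc ⟨by linarith [hτI.1, pi_pos], hτI.2.le⟩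
  have hs : 0 ≤ sin τ := sin_nonneg_of_nonneg_of_le_pi hτI.1.le (by linarith [hτI.2, pi_pos])
  calc (n * √(1 - x ^ 2)) ^ (d + 1) * (jacobiPoly d n).eval x ^ 2
      = 2 ^ (d + 1) * ((n * sin τ) ^ (d + 1) * cos τ ^ (d + 1) *
          (jacobiPoly d n).eval x ^ 2) := by rw [hsin]; ring
    _ ≤ 2 ^ (d + 1) * ((n * sin τ) ^ (d + 1) * cos τ * (jacobiPoly d n).eval x ^ 2) := by
        gcongr
        exact pow_le_of_le_one hc (cos_le_one τ) (Nat.succ_ne_zero d)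
    _ ≤ 2 ^ (d + 1) * (7 * ((d : ℝ) + 1) ^ (d + 1)) := by gcongr
    _ = 7 * (2 * ((d : ℝ) + 1)) ^ (d + 1) := by rw [mul_pow]; ring

/-- Interpolation between the trivial bound and the envelope. -/
lemma jacobiPoly_decay_rpow {d n : ℕ} (hd : 1 ≤ d) (hn : 2 * (d + 1) ≤ n) {x κ : ℝ}
    (hx : x ∈ Set.Ioo (-1 : ℝ) 1) (hκ0 : 0 ≤ κ) (hκ : κ ≤ d + 1) :
    (n * √(1 - x ^ 2)) ^ κ * (jacobiPoly d n).eval x ^ 2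
      ≤ 7 * (2 * ((d : ℝ) + 1)) ^ (d + 1) := by
  have hy := sq_eval_jacobiPoly_le_one (d := d) (by exact_mod_cast hd) n
    (Set.Ioo_subset_Icc_self hx)
  have h := jacobiPoly_decay hd hn hx
  set R := n * √(1 - x ^ 2) with hR
  have hR0 : 0 ≤ R := by positivity
  rcases le_total R 1 with h1 | h1
  · have h2 : R ^ κ ≤ 1 := rpow_le_one hR0 h1 hκ0
    have h3 : (1 : ℝ) ≤ (2 * ((d : ℝ) + 1)) ^ (d + 1) :=
      one_le_pow₀ (by linarith [(d.cast_nonneg : (0 : ℝ) ≤ d)])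
    have h4 : R ^ κ * (jacobiPoly d n).eval x ^ 2 ≤ 1 :=
      mul_le_one₀ h2 (sq_nonneg _) hy
    linarith
  · refine le_trans ?_ h
    gcongr
    rw [← rpow_natCast]
    exact rpow_le_rpow_of_exponent_le h1 (by push_cast; exact hκ)

end Gossip

/-! ### Mean squared error as an ℓ² norm, and the lower bound for all methods -/

namespace Gossip
open MeasureTheory ProbabilityTheory

/-- The mean squared error of a weighted average of i.i.d. observations. -/
lemma integral_sq_linearCombination_sub_mean {V : Type*} {ν : Measure ℝ}
    [IsProbabilityMeasure ν] (hν : MemLp id 2 ν) {Ω : Type*} [MeasurableSpace Ω] {Pr : Measure Ω}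
    [IsProbabilityMeasure Pr] {ξ : V → Ω → ℝ} (hlaw : ∀ w, HasLaw (ξ w) ν Pr)
    (hindep : iIndepFun ξ Pr) (K : V →₀ ℝ) (hK : Finsupp.linearCombination ℝ (fun _ => (1 : ℝ)) K = 1) :
    ∫ ω, (Finsupp.linearCombination ℝ (fun w => ξ w ω) K - ∫ y, y ∂ν) ^ 2 ∂Pr =
      variance id ν * ∑ w ∈ K.support, K w ^ 2 := by
  have hmem : ∀ w, MemLp (ξ w) 2 Pr := fun w => by
    have := (hlaw w).map_eq ▸ hν
    exact (memLp_map_measure_iff aestronglyMeasurable_id (hlaw w).aemeasurable).1 this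
  set X : V → Ω → ℝ := fun w ω => K w * ξ w ω with hX
  have hXmem : ∀ w, MemLp (X w) 2 Pr := fun w => (hmem w).const_mul (K w)
  have hsum : ∀ ω, Finsupp.linearCombination ℝ (fun w => ξ w ω) K = (∑ w ∈ K.support, X w) ω := by
    intro ω
    simp [Finsupp.linearCombination_apply, Finsupp.sum, hX]
  have hmean : ∫ ω, (∑ w ∈ K.support, X w) ω ∂Pr = ∫ y, y ∂ν := by
    simp only [Finset.sum_apply]
    rw [integral_finsetSum _ fun w _ => (hXmem w).integrable one_le_two]
    simp only [hX, integral_const_mul, (hlaw _).integral_eq]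
    rw [← Finset.sum_mul]
    simp only [Finsupp.linearCombination_apply, Finsupp.sum, smul_eq_mul, mul_one] at hK
    rw [hK, one_mul]
  have hvar : variance (∑ w ∈ K.support, X w) Pr = variance id ν * ∑ w ∈ K.support, K w ^ 2 := by
    rw [IndepFun.variance_sum fun w _ => hXmem w, Finset.mul_sum]
    · refine Finset.sum_congr rfl fun w _ => ?_
      rw [hX, variance_const_mul, (hlaw w).variance_eq, mul_comm]
    · intro w _ w' _ hww'
      exact (hindep.indepFun hww').comp (measurable_const_mul (K w)) (measurable_const_mul (K w'))
  rw [← hvar, variance_eq_integral, hmean]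
  · simp only [hsum]
  · exact (memLp_finsetSum' K.support fun w _ => hXmem w).aemeasurable

/-- The box of radius `t` around `v`. -/
noncomputable def box {d : ℕ} (v : Fin d → ℤ) (t : ℕ) : Finset (Fin d → ℤ) :=
  Finset.Icc (fun i => v i - t) (fun i => v i + t)

lemma mem_box {d : ℕ} {v w : Fin d → ℤ} {t : ℕ} : w ∈ box v t ↔ ∀ i, |w i - v i| ≤ t := by
  simp only [box, Finset.mem_Icc, Pi.le_def, abs_le]
  constructor
  · rintro ⟨h1, h2⟩ i
    constructor <;> linarith [h1 i, h2 i]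
  · intro h
    constructor <;> intro i <;> linarith [(h i).1, (h i).2]

/-- The ℓ^∞ box is larger than the ℓ¹ ball that a walk can reach, but it is easy to count and has
the same order `t^d`. -/
lemma card_box {d : ℕ} (v : Fin d → ℤ) (t : ℕ) : (box v t).card = (2 * t + 1) ^ d := by
  rw [box, Pi.card_Icc]
  simp only [Int.card_Icc]
  rw [Finset.prod_eq_pow_card (b := 2 * t + 1)]
  · simp
  · intro i _
    omega

lemma IsGossipMatrix.mem_box {d : ℕ} {W : Matrix (Fin d → ℤ) (Fin d → ℤ) ℝ}
    (hW : IsGossipMatrix (gridGraph d) W) {v w : Fin d → ℤ} (hne : W v w ≠ 0) : w ∈ box v 1 := by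
  rw [Gossip.mem_box]
  intro i
  by_cases hvw : v = w
  · simp [hvw]
  · have h1 : ∑ i, |v i - w i| = 1 := hW.supported v w hvw ((hW.nonneg v w).lt_of_ne' hne)
    rw [abs_sub_comm, Nat.cast_one, ← h1]
    exact Finset.single_le_sum (f := fun i => |v i - w i|) (fun _ _ => abs_nonneg _)
      (Finset.mem_univ i)

/-- `finsum` is 0 on infinite supports; the unit box ensures that the product is a genuine sum. -/
lemma act_eq_sum_box {d : ℕ} {W : Matrix (Fin d → ℤ) (Fin d → ℤ) ℝ}
    (hW : IsGossipMatrix (gridGraph d) W) (x : (Fin d → ℤ) → ℝ) (v : Fin d → ℤ) :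
    act W x v = ∑ w ∈ box v 1, W v w * x w :=
  finsum_eq_sum_of_support_subset _ fun _ hw => hW.mem_box (left_ne_zero_of_mul hw)

lemma act_one {d : ℕ} {W : Matrix (Fin d → ℤ) (Fin d → ℤ) ℝ}
    (hW : IsGossipMatrix (gridGraph d) W) : act W (fun _ => 1) = fun _ => 1 := by
  funext v
  rw [act_eq_sum_box hW]
  refine Eq.trans ?_ (hW.stochastic v).tsum_eq
  rw [tsum_eq_sum (s := box v 1)]
  · exact Finset.sum_congr rfl fun w _ => mul_one _
  · exact fun w hw => by_contra fun hne => hw (hW.mem_box hne)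

/-- Each row of a power of a gossip matrix on the grid is supported by a box. -/
lemma exists_row_iterate {d : ℕ} {W : Matrix (Fin d → ℤ) (Fin d → ℤ) ℝ}
    (hW : IsGossipMatrix (gridGraph d) W) (i : ℕ) (v : Fin d → ℤ) :
    ∃ K : (Fin d → ℤ) →₀ ℝ, K ∈ Finsupp.supported ℝ ℝ (box v i : Set (Fin d → ℤ)) ∧
      ∀ ξ, (act W)^[i] ξ v = Finsupp.linearCombination ℝ ξ K := by
  induction i generalizing v with
  | zero =>
    refine ⟨Finsupp.single v 1, Finsupp.single_mem_supported ℝ _ ?_, fun ξ => by simp⟩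
    simp [mem_box]
  | succ i ih =>
    choose K hK hKξ using ih
    refine ⟨∑ u ∈ box v 1, W v u • K u, ?_, fun ξ => ?_⟩
    · refine Submodule.sum_mem _ fun u hu => Submodule.smul_mem _ _ ?_
      refine Finsupp.supported_mono (fun w hw => ?_) (hK u)
      rw [Finset.mem_coe, mem_box] at *
      intro j
      have := abs_sub_le (w j) (u j) (v j)
      push_cast at hu ⊢
      linarith [hw j, hu j]
    · rw [Function.iterate_succ_apply', act_eq_sum_box hW]
      simp [hKξ]

/-- Each row of a polynomial in a gossip matrix on the grid is supported by a box. -/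
lemma exists_row_polyAct {d : ℕ} {W : Matrix (Fin d → ℤ) (Fin d → ℤ) ℝ}
    (hW : IsGossipMatrix (gridGraph d) W) {P : Polynomial ℝ} {t : ℕ} (hP : P.natDegree ≤ t)
    (hP1 : P.eval 1 = 1) (v : Fin d → ℤ) :
    ∃ K : (Fin d → ℤ) →₀ ℝ, K.support ⊆ box v t ∧
      Finsupp.linearCombination ℝ (fun _ => (1 : ℝ)) K = 1 ∧
      ∀ ξ, polyAct P W ξ v = Finsupp.linearCombination ℝ ξ K := by
  choose K hK hKξ using fun i => exists_row_iterate hW i v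
  set L := ∑ i ∈ P.support, P.coeff i • K i with hL
  have hLξ : ∀ ξ, polyAct P W ξ v = Finsupp.linearCombination ℝ ξ L := fun ξ => by
    simp [polyAct, Polynomial.sum_def, hL, hKξ]
  refine ⟨L, ?_, ?_, hLξ⟩
  · rw [← Finset.coe_subset]
    refine (Finsupp.mem_supported ℝ L).1 (Submodule.sum_mem _ fun i hi => Submodule.smul_mem _ _ ?_)
    refine Finsupp.supported_mono (fun w hw => ?_) (hK i)
    rw [Finset.mem_coe, mem_box] at *
    have : (i : ℤ) ≤ t := by exact_mod_cast (Polynomial.le_natDegree_of_mem_supp i hi).trans hP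
    exact fun j => (hw j).trans this
  · rw [← hLξ, polyAct, Polynomial.sum_def]
    have hit : ∀ i, (act W)^[i] (fun _ => (1 : ℝ)) = fun _ => 1 := fun i =>
      Function.iterate_fixed (act_one hW) i
    rw [Polynomial.eval_eq_sum, Polynomial.sum_def] at hP1
    simpa [hit] using hP1

/-- A probability-like row supported by a box of radius `t` has large `ℓ²` norm. -/
lemma one_le_mul_sum_sq_of_support_subset_box {d t : ℕ} {v : Fin d → ℤ}
    {K : (Fin d → ℤ) →₀ ℝ} (hK : K.support ⊆ box v t)
    (hK1 : Finsupp.linearCombination ℝ (fun _ => (1 : ℝ)) K = 1) :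
    1 ≤ (2 * (t : ℝ) + 1) ^ d * ∑ w ∈ K.support, K w ^ 2 := by
  simp only [Finsupp.linearCombination_apply, Finsupp.sum, smul_eq_mul, mul_one] at hK1
  -- Cauchy–Schwarz; the entries of the row may have any sign.
  have h := sq_sum_le_card_mul_sum_sq (s := K.support) (f := K)
  rw [hK1, one_pow] at h
  refine h.trans ?_
  gcongr
  have := Finset.card_le_card hK
  rw [card_box] at this
  exact_mod_cast this

/-- No polynomial gossip method on the grid beats the rate `t ^ (-d)`. -/
lemma IsPolynomialGossip.variance_le {d : ℕ} {x : ((Fin d → ℤ) → ℝ) → ℕ → (Fin d → ℤ) → ℝ}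
    (hx : IsPolynomialGossip (gridGraph d) x) {ν : Measure ℝ}
    [IsProbabilityMeasure ν] (hν : MemLp id 2 ν) {Ω : Type*} [MeasurableSpace Ω] {Pr : Measure Ω}
    [IsProbabilityMeasure Pr] {ξ : (Fin d → ℤ) → Ω → ℝ} (hlaw : ∀ w, HasLaw (ξ w) ν Pr)
    (hindep : iIndepFun ξ Pr) (v : Fin d → ℤ) (t : ℕ) :
    variance id ν ≤ (2 * (t : ℝ) + 1) ^ d *
      ∫ ω, (x (fun w => ξ w ω) t v - ∫ y, y ∂ν) ^ 2 ∂Pr := by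
  obtain ⟨W, P, hW, hP, hxP⟩ := hx
  obtain ⟨K, hK, hK1, hKξ⟩ := exists_row_polyAct hW (hP t).1 (hP t).2 v
  simp only [hxP, hKξ]
  rw [integral_sq_linearCombination_sub_mean hν hlaw hindep K hK1]
  have h := one_le_mul_sum_sq_of_support_subset_box hK hK1
  nlinarith [variance_nonneg id ν]

end Gossip

/-! ### The simple random walk as an element of the group algebra -/

namespace Gossip

/-- The generator of the simple random walk on `ℤ^d`, in the group algebra. -/
noncomputable def gridStep (d : ℕ) : AddMonoidAlgebra ℝ (Fin d → ℤ) :=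
  (2 * (d : ℝ))⁻¹ • ∑ i, (AddMonoidAlgebra.single (Pi.single i 1) 1
    + AddMonoidAlgebra.single (-Pi.single i 1) 1)

/-- The action of the group algebra on functions by translations. -/
noncomputable def shift (G : Type*) [AddCommGroup G] :
    AddMonoidAlgebra ℝ G →ₐ[ℝ] Module.End ℝ (G → ℝ) :=
  AddMonoidAlgebra.lift ℝ (Module.End ℝ (G → ℝ)) G
    { toFun := fun u => LinearMap.funLeft ℝ ℝ fun v => v + u.toAdd
      map_one' := by ext; simp [LinearMap.funLeft]
      map_mul' := fun u w => by
        refine LinearMap.ext fun x => funext fun v => ?_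
        simp [LinearMap.funLeft, add_assoc] }

lemma shift_apply {G : Type*} [AddCommGroup G] (q : AddMonoidAlgebra ℝ G) (x : G → ℝ) (v : G) :
    shift G q x v = ∑ u ∈ q.coeff.support, q.coeff u * x (v + u) := by
  rw [shift, AddMonoidAlgebra.lift_apply, Finsupp.sum, LinearMap.sum_apply, Finset.sum_apply]
  rfl

/-- A unit vector for the `ℓ¹` norm on `ℤ^d` is, up to sign, a vector of the canonical basis. -/
lemma ite_sum_abs_eq_one {d : ℕ} (u : Fin d → ℤ) :
    (if ∑ i, |u i| = 1 then (1 : ℝ) else 0) =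
      ∑ i, ((if Pi.single i 1 = u then (1 : ℝ) else 0) + if -Pi.single i 1 = u then 1 else 0) := by
  split_ifs with h
  · obtain ⟨i, hi⟩ : ∃ i, u i ≠ 0 := by
      by_contra! hu
      simp [hu] at h
    have hsplit := Finset.add_sum_erase Finset.univ (fun j => |u j|) (Finset.mem_univ i)
    have h1 : 1 ≤ |u i| := Int.one_le_abs hi
    have h2 : 0 ≤ ∑ j ∈ Finset.univ.erase i, |u j| := Finset.sum_nonneg fun _ _ => abs_nonneg _
    have h3 : ∑ j ∈ Finset.univ.erase i, |u j| = 0 := by omega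
    have h4 : ∀ j, j ≠ i → u j = 0 := fun j hj => by
      have := (Finset.sum_eq_zero_iff_of_nonneg fun _ _ => abs_nonneg _).1 h3 j
        (Finset.mem_erase.2 ⟨hj, Finset.mem_univ j⟩)
      exact abs_eq_zero.1 this
    have hu : u = Pi.single i (u i) := by
      funext j
      by_cases hj : j = i
      · subst hj; simp
      · simp [hj, h4 j hj]
    have h5 : u i = 1 ∨ u i = -1 := by
      have : |u i| = 1 := by omega
      exact eq_or_eq_neg_of_abs_eq this
    rw [Finset.sum_eq_single i]
    · rw [hu]
      rcases h5 with h5 | h5 <;> rw [h5]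
      · have : ¬ (-Pi.single i 1 : Fin d → ℤ) = Pi.single i 1 := fun h => by
          have := congrFun h i; simp at this
        simp [this]
      · have : ¬ (Pi.single i 1 : Fin d → ℤ) = -Pi.single i 1 := fun h => by
          have := congrFun h i; simp at this
        simp [this, Pi.single_neg]
    · intro j _ hj
      have e1 : ¬ (Pi.single j 1 : Fin d → ℤ) = u := fun h => by
        have := congrFun h j; simp [h4 j hj] at this
      have e2 : ¬ (-Pi.single j 1 : Fin d → ℤ) = u := fun h => by
        have := congrFun h j; simp [h4 j hj] at this
      simp [e1, e2]
    · simp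
  · symm
    refine Finset.sum_eq_zero fun i _ => ?_
    have habs : ∑ j, |(Pi.single i 1 : Fin d → ℤ) j| = 1 := by
      rw [Finset.sum_eq_single i] <;> simp +contextual
    have e1 : ¬ (Pi.single i 1 : Fin d → ℤ) = u := by rintro rfl; exact h habs
    have e2 : ¬ (-Pi.single i 1 : Fin d → ℤ) = u := by
      rintro rfl; exact h (by simpa only [Pi.neg_apply, abs_neg] using habs)
    simp [e1, e2]

lemma gridMatrix_apply (d : ℕ) (v w : Fin d → ℤ) :
    gridMatrix d v w = (gridStep d).coeff (w - v) := by
  have h : (gridGraph d).adjMatrix ℝ v w = if ∑ i, |(w - v) i| = 1 then (1 : ℝ) else 0 := by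
    rw [SimpleGraph.adjMatrix_apply]
    simp only [gridGraph, Pi.sub_apply, abs_sub_comm (v _)]
  rw [gridMatrix, Matrix.smul_apply, h, ite_sum_abs_eq_one, gridStep]
  simp [AddMonoidAlgebra.coeff_sum, Finsupp.single_apply]

/-- Translation invariance: `shift` being an algebra homomorphism, polynomials in the matrix become
polynomials in `gridStep`, on which characters can be evaluated. -/
lemma act_gridMatrix (d : ℕ) : act (gridMatrix d) = shift _ (gridStep d) := by
  funext x v
  rw [shift_apply, act]
  simp only [gridMatrix_apply]
  rw [← finsum_comp_equiv (Equiv.addLeft v)]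
  simp only [Equiv.coe_addLeft, add_sub_cancel_left]
  exact finsum_eq_sum_of_support_subset _ fun u hu =>
    Finsupp.mem_support_iff.2 (left_ne_zero_of_mul hu)

lemma shift_gridStep_one {d : ℕ} (hd : 1 ≤ d) :
    shift _ (gridStep d) (fun _ => (1 : ℝ)) = fun _ => 1 := by
  have hd0 : (d : ℝ) ≠ 0 := by exact_mod_cast (by omega : d ≠ 0)
  funext v
  simp only [gridStep, map_smul, map_sum, map_add, shift, AddMonoidAlgebra.lift_single]
  simp [LinearMap.funLeft]
  field_simp
  norm_num

lemma isGossipMatrix_gridMatrix {d : ℕ} (hd : 1 ≤ d) :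
    IsGossipMatrix (gridGraph d) (gridMatrix d) where
  nonneg v w := by
    rw [gridMatrix, Matrix.smul_apply, SimpleGraph.adjMatrix_apply]
    split_ifs <;> simp
  supported v w _ hvw := by
    by_contra h
    simp [gridMatrix, h] at hvw
  stochastic v := by
    simp only [gridMatrix_apply]
    have h := congrFun (shift_gridStep_one hd) v
    simp only [shift_apply, mul_one] at h
    rw [← h, ← (Equiv.addLeft v).hasSum_iff]
    simp only [Function.comp_def, Equiv.coe_addLeft, add_sub_cancel_left]
    exact hasSum_sum_of_ne_finset_zero fun u hu => Finsupp.notMem_support_iff.1 hu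
  symmetric v w := by
    simp only [gridMatrix, Matrix.smul_apply, SimpleGraph.adjMatrix_apply, SimpleGraph.adj_comm]

lemma polyAct_gridMatrix (d : ℕ) (P : Polynomial ℝ) (ξ : (Fin d → ℤ) → ℝ) :
    polyAct P (gridMatrix d) ξ = shift _ (Polynomial.aeval (gridStep d) P) ξ := by
  rw [← Polynomial.aeval_algHom_apply, Polynomial.aeval_eq_sum_range, polyAct,
    Polynomial.sum_over_range _ (by simp), LinearMap.sum_apply]
  refine Finset.sum_congr rfl fun i _ => ?_
  rw [act_gridMatrix, LinearMap.smul_apply, Module.End.pow_apply]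

lemma jacobiIteration_gridMatrix (d : ℕ) (ξ : (Fin d → ℤ) → ℝ) (t : ℕ) :
    jacobiIteration d (gridMatrix d) ξ t =
      shift _ (Polynomial.aeval (gridStep d) (jacobiPoly d t)) ξ := by
  induction t using Nat.twoStepInduction with
  | zero => simp [jacobiIteration, jacobiPoly]
  | one =>
    simp [jacobiIteration, jacobiPoly, act_gridMatrix,
      Polynomial.aeval_C, Algebra.algebraMap_eq_smul_one]
  | more t ih ih' =>
    rw [jacobiIteration, ih, ih', act_gridMatrix, jacobiPoly]
    simp [Polynomial.aeval_C, Algebra.algebraMap_eq_smul_one]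

lemma isPolynomialGossip_jacobiIteration {d : ℕ} (hd : 1 ≤ d) :
    IsPolynomialGossip (gridGraph d) (jacobiIteration d (gridMatrix d)) :=
  ⟨gridMatrix d, jacobiPoly d, isGossipMatrix_gridMatrix hd,
    fun t => ⟨natDegree_jacobiPoly_le d t, eval_one_jacobiPoly (by exact_mod_cast hd) t⟩,
    fun ξ t => by rw [jacobiIteration_gridMatrix, polyAct_gridMatrix]⟩

end Gossip

/-! ### Fourier transform and Parseval -/

namespace Gossip
open MeasureTheory Real

/-- The uniform probability measure on the cube `(0, 1]^d`. -/
noncomputable def cubeMeasure (d : ℕ) : Measure (Fin d → ℝ) :=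
  Measure.pi fun _ => volume.restrict (Set.Ioc 0 1)

instance (d : ℕ) : IsFiniteMeasure (cubeMeasure d) := by
  unfold cubeMeasure; infer_instance

/-- The symbol of the simple random walk. -/
noncomputable def symbol (d : ℕ) (p : Fin d → ℝ) : ℝ :=
  (d : ℝ)⁻¹ * ∑ i, cos (2 * π * p i)

/-- The Fourier transform at the frequency `p`, as a character of the group algebra. -/
noncomputable def fourierHom {d : ℕ} (p : Fin d → ℝ) :
    AddMonoidAlgebra ℝ (Fin d → ℤ) →ₐ[ℝ] ℂ :=
  AddMonoidAlgebra.lift ℝ ℂ (Fin d → ℤ)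
    { toFun := fun u => ∏ i, Complex.exp (2 * π * Complex.I * u.toAdd i * p i)
      map_one' := by simp
      map_mul' := fun u w => by
        rw [← Finset.prod_mul_distrib]
        refine Finset.prod_congr rfl fun i _ => ?_
        rw [← Complex.exp_add]
        congr 1
        simp only [toAdd_mul, Pi.add_apply, Int.cast_add]
        ring }

lemma fourierHom_single {d : ℕ} (p : Fin d → ℝ) (u : Fin d → ℤ) (c : ℝ) :
    fourierHom p (AddMonoidAlgebra.single u c) =
      c * ∏ i, Complex.exp (2 * π * Complex.I * u i * p i) := by
  rw [fourierHom, AddMonoidAlgebra.lift_single, Complex.real_smul]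
  rfl

lemma fourierHom_apply {d : ℕ} (p : Fin d → ℝ) (q : AddMonoidAlgebra ℝ (Fin d → ℤ)) :
    fourierHom p q = ∑ u ∈ q.coeff.support,
      (q.coeff u : ℂ) * ∏ i, Complex.exp (2 * π * Complex.I * u i * p i) := by
  rw [fourierHom, AddMonoidAlgebra.lift_apply, Finsupp.sum]
  simp only [Complex.real_smul]
  rfl

lemma fourierHom_gridStep {d : ℕ} (p : Fin d → ℝ) :
    fourierHom p (gridStep d) = (symbol d p : ℂ) := by
  have key : ∀ i (z : ℤ), ∏ j, Complex.exp
      (2 * π * Complex.I * (Pi.single i z : Fin d → ℤ) j * p j) =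
        Complex.exp (2 * π * Complex.I * z * p i) := fun i z => by
    rw [Finset.prod_eq_single i]
    · simp
    · intro j _ hj; simp [hj]
    · simp
  rw [gridStep, map_smul, map_sum, symbol]
  simp only [map_add, fourierHom_single, ← Pi.single_neg, key]
  rw [Complex.real_smul]
  push_cast
  rw [mul_inv, mul_comm (2 : ℂ)⁻¹, mul_assoc, Finset.mul_sum]
  congr 1
  refine Finset.sum_congr rfl fun i _ => ?_
  rw [Complex.cos]
  ring_nf

lemma fourierHom_aeval_gridStep {d : ℕ} (p : Fin d → ℝ) (P : Polynomial ℝ) :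
    fourierHom p (Polynomial.aeval (gridStep d) P) = ((P.eval (symbol d p) : ℝ) : ℂ) := by
  rw [← Polynomial.aeval_algHom_apply, fourierHom_gridStep]
  exact Polynomial.aeval_algebraMap_apply_eq_algebraMap_eval (A := ℂ) (symbol d p) P

lemma symbol_neg {d : ℕ} (p : Fin d → ℝ) : symbol d (-p) = symbol d p := by
  simp [symbol]

lemma integral_exp_int_mul (n : ℤ) :
    ∫ x : ℝ in Set.Ioc 0 1, Complex.exp (2 * π * Complex.I * n * x) = if n = 0 then 1 else 0 := by
  rw [← intervalIntegral.integral_of_le zero_le_one]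
  split_ifs with h
  · simp [h]
  · have hc : 2 * π * Complex.I * n ≠ 0 := by
      simp [h, pi_ne_zero]
    rw [integral_exp_mul_complex hc]
    have : Complex.exp (2 * π * Complex.I * n) = 1 := by
      rw [mul_comm]; exact Complex.exp_int_mul_two_pi_mul_I n
    simp [this]

lemma integral_prod_exp {d : ℕ} (u : Fin d → ℤ) :
    ∫ p, ∏ i, Complex.exp (2 * π * Complex.I * u i * p i) ∂(cubeMeasure d) =
      if u = 0 then 1 else 0 := by
  rw [cubeMeasure, integral_fintype_prod_eq_prod
    (fun i (x : ℝ) => Complex.exp (2 * π * Complex.I * u i * x))]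
  simp only [integral_exp_int_mul]
  rw [Finset.prod_ite_zero]
  simp [funext_iff]

/-- Parseval's identity for the rows of polynomials in the simple random walk. -/
lemma integral_sq_eval_symbol {d : ℕ} (P : Polynomial ℝ) :
    ∫ p, P.eval (symbol d p) ^ 2 ∂(cubeMeasure d) =
      ∑ u ∈ (Polynomial.aeval (gridStep d) P).coeff.support,
        (Polynomial.aeval (gridStep d) P).coeff u ^ 2 := by
  set q := Polynomial.aeval (gridStep d) P with hq
  have hprod : ∀ p : Fin d → ℝ, ((P.eval (symbol d p) ^ 2 : ℝ) : ℂ) =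
      ∑ u ∈ q.coeff.support, ∑ w ∈ q.coeff.support, (q.coeff u * q.coeff w : ℂ) *
        ∏ i, Complex.exp (2 * π * Complex.I * ((u - w) i : ℤ) * p i) := by
    intro p
    have h1 := fourierHom_aeval_gridStep p P
    -- The symbol is even, so the square is the transform at `p` times the transform at `-p`. This
    -- replaces complex conjugation and produces the characters of `u - w`.
    have h2 := fourierHom_aeval_gridStep (-p) P
    rw [symbol_neg] at h2
    rw [sq, Complex.ofReal_mul]
    nth_rw 1 [← h1]
    rw [← h2, fourierHom_apply, fourierHom_apply, Finset.sum_mul_sum]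
    refine Finset.sum_congr rfl fun u _ => Finset.sum_congr rfl fun w _ => ?_
    rw [mul_mul_mul_comm, ← Finset.prod_mul_distrib]
    congr 1
    refine Finset.prod_congr rfl fun i _ => ?_
    rw [← Complex.exp_add]
    congr 1
    simp only [Pi.neg_apply, Pi.sub_apply]
    push_cast
    ring
  have hint : ∀ u : Fin d → ℤ, Integrable
      (fun p : Fin d → ℝ => ∏ i, Complex.exp (2 * π * Complex.I * u i * p i)) (cubeMeasure d) := by
    intro u
    refine Integrable.of_bound (Continuous.aestronglyMeasurable (by fun_prop)) 1
      (Filter.Eventually.of_forall fun p => ?_)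
    rw [norm_prod]
    refine Finset.prod_le_one (fun _ _ => norm_nonneg _) fun i _ => le_of_eq ?_
    rw [Complex.norm_exp]
    simp
  rw [← Complex.ofReal_inj, ← integral_complex_ofReal]
  simp only [hprod]
  rw [integral_finsetSum _ fun u _ => integrable_finsetSum _ fun w _ => (hint _).const_mul _]
  push_cast
  refine Finset.sum_congr rfl fun u hu => ?_
  rw [integral_finsetSum _ fun w _ => (hint _).const_mul _]
  simp only [integral_const_mul, integral_prod_exp, sub_eq_zero]
  simp [hu, sq]

end Gossip

/-! ### The spectral integral -/

namespace Gossip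
open MeasureTheory Real

/-- Jordan's inequality `sin x ≥ 2x/π` compares with `x^(-γ)` on `[0, π/2]`; reflection and
periodicity do the rest. -/
lemma intervalIntegrable_abs_sin_rpow_neg {γ : ℝ} (hγ0 : 0 ≤ γ) (hγ : γ < 1) (a b : ℝ) :
    IntervalIntegrable (fun x => |sin x| ^ (-γ)) volume a b := by
  have hper : Function.Periodic (fun x => |sin x| ^ (-γ)) π := fun x => by
    simp [sin_add_pi]
  have h1 : IntervalIntegrable (fun x => |sin x| ^ (-γ)) volume 0 (π / 2) := by
    have h0 : IntervalIntegrable (fun x : ℝ => (2 / π) ^ (-γ) * x ^ (-γ)) volume 0 (π / 2) :=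
      (intervalIntegral.intervalIntegrable_rpow' (by linarith)).const_mul _
    refine h0.mono_fun' (Measurable.aestronglyMeasurable (by fun_prop)) ?_
    rw [Set.uIoc_of_le (by positivity)]
    refine (ae_restrict_iff' measurableSet_Ioc).2 (Filter.Eventually.of_forall fun x hx => ?_)
    have hs : 2 / π * x ≤ sin x := mul_le_sin hx.1.le hx.2
    have hpos : 0 < 2 / π * x := mul_pos (by positivity) hx.1
    beta_reduce
    rw [norm_of_nonneg (by positivity), abs_of_pos (hpos.trans_le hs),
      ← mul_rpow (by positivity) hx.1.le]
    exact rpow_le_rpow_of_nonpos hpos hs (by linarith)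
  have h2 : IntervalIntegrable (fun x => |sin x| ^ (-γ)) volume (π / 2) π := by
    have := (h1.comp_sub_left π).symm
    simp only [sin_pi_sub, sub_zero] at this
    convert this using 1
    ring
  exact hper.intervalIntegrable₀ pi_ne_zero (h1.trans h2) a b

lemma integrableOn_abs_sin_rpow_neg {γ : ℝ} (hγ0 : 0 ≤ γ) (hγ : γ < 1) :
    Integrable (fun x => |sin (2 * π * x)| ^ (-γ)) (volume.restrict (Set.Ioc 0 1)) := by
  have h := (intervalIntegrable_abs_sin_rpow_neg hγ0 hγ 0 (2 * π)).comp_mul_left (c := 2 * π)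
  rw [zero_div, div_self (by positivity), intervalIntegrable_iff_integrableOn_Ioc_of_le
    zero_le_one] at h
  exact h

lemma ae_sin_ne_zero :
    ∀ᵐ x ∂(volume.restrict (Set.Ioc (0 : ℝ) 1)), sin (2 * π * x) ≠ 0 := by
  refine ae_restrict_of_ae ?_
  have hc : ({x : ℝ | sin (2 * π * x) = 0}).Countable := by
    refine (Set.countable_range fun n : ℤ => (n : ℝ) / 2).mono fun x hx => ?_
    obtain ⟨n, hn⟩ := sin_eq_zero_iff.1 hx
    refine ⟨n, ?_⟩
    have : π * ((n : ℝ) - 2 * x) = 0 := by linarith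
    rcases mul_eq_zero.1 this with h | h
    · exact absurd h pi_ne_zero
    · simp only; linarith
  filter_upwards [hc.ae_notMem volume] with x hx using hx

/-- AM–GM is applied separately to the numbers `1 - cos` and `1 + cos`, whose averages are `1 - σ`
and `1 + σ`; multiplying uses `(1 - cos)(1 + cos) = sin²`. The singularities of the spectral
integral thereby split into separate variables. -/
lemma prod_abs_sin_rpow_le {d : ℕ} (hd : 1 ≤ d) (p : Fin d → ℝ) :
    ∏ i, (|sin (2 * π * p i)|) ^ (1 / (d : ℝ)) ≤ √(1 - symbol d p ^ 2) := by
  have hd0 : (d : ℝ) ≠ 0 := by exact_mod_cast (by omega : d ≠ 0)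
  have hw : ∑ _i : Fin d, 1 / (d : ℝ) = 1 := by
    simp [hd0]
  have h1 := geom_mean_le_arith_mean_weighted Finset.univ (fun _ : Fin d => 1 / (d : ℝ))
    (fun i => 1 - cos (2 * π * p i)) (fun _ _ => by positivity) hw
    (fun i _ => by linarith [cos_le_one (2 * π * p i)])
  have h2 := geom_mean_le_arith_mean_weighted Finset.univ (fun _ : Fin d => 1 / (d : ℝ))
    (fun i => 1 + cos (2 * π * p i)) (fun _ _ => by positivity) hw
    (fun i _ => by linarith [neg_one_le_cos (2 * π * p i)])
  have e1 : ∑ i, 1 / (d : ℝ) * (1 - cos (2 * π * p i)) = 1 - symbol d p := by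
    simp only [mul_sub, Finset.sum_sub_distrib, mul_one, hw, symbol, Finset.mul_sum, ← one_div]
  have e2 : ∑ i, 1 / (d : ℝ) * (1 + cos (2 * π * p i)) = 1 + symbol d p := by
    simp only [mul_add, Finset.sum_add_distrib, mul_one, hw, symbol, Finset.mul_sum, ← one_div]
  simp only [e1] at h1
  simp only [e2] at h2
  have n1 : ∀ i, 0 ≤ 1 - cos (2 * π * p i) := fun i => by linarith [cos_le_one (2 * π * p i)]
  have n2 : ∀ i, 0 ≤ 1 + cos (2 * π * p i) := fun i => by linarith [neg_one_le_cos (2 * π * p i)]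
  have p1 : 0 ≤ ∏ i, (1 - cos (2 * π * p i)) ^ (1 / (d : ℝ)) :=
    Finset.prod_nonneg fun i _ => rpow_nonneg (n1 i) _
  have p2 : 0 ≤ ∏ i, (1 + cos (2 * π * p i)) ^ (1 / (d : ℝ)) :=
    Finset.prod_nonneg fun i _ => rpow_nonneg (n2 i) _
  refine le_sqrt_of_sq_le ?_
  calc (∏ i, (|sin (2 * π * p i)|) ^ (1 / (d : ℝ))) ^ 2
      = (∏ i, (1 - cos (2 * π * p i)) ^ (1 / (d : ℝ))) *
          ∏ i, (1 + cos (2 * π * p i)) ^ (1 / (d : ℝ)) := by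
        rw [sq, ← Finset.prod_mul_distrib, ← Finset.prod_mul_distrib]
        refine Finset.prod_congr rfl fun i _ => ?_
        rw [← mul_rpow (abs_nonneg _) (abs_nonneg _), ← mul_rpow (n1 i) (n2 i)]
        congr 1
        rw [abs_mul_abs_self]
        linarith [sin_sq_add_cos_sq (2 * π * p i)]
    _ ≤ (1 - symbol d p) * (1 + symbol d p) := mul_le_mul h1 h2 p2 (p1.trans h1)
    _ = 1 - symbol d p ^ 2 := by ring

/-- The `ℓ²` norm of the rows of the Jacobi iteration decays at any rate below `n ^ (-d)`. -/
lemma exists_integral_sq_jacobiPoly_le {d : ℕ} (hd : 1 ≤ d) {κ : ℝ} (hκ0 : 0 < κ) (hκ : κ < d) :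
    ∃ C : ℝ, 0 < C ∧ ∀ n : ℕ, 2 * (d + 1) ≤ n →
      ∫ p, (jacobiPoly d n).eval (symbol d p) ^ 2 ∂(cubeMeasure d) ≤ C * (n : ℝ) ^ (-κ) := by
  have hd0 : (0 : ℝ) < d := by exact_mod_cast hd
  set A : ℝ := 7 * (2 * ((d : ℝ) + 1)) ^ (d + 1) with hA
  set g : (Fin d → ℝ) → ℝ := fun p => ∏ i, (|sin (2 * π * p i)|) ^ (-(κ / d)) with hg
  have hgint : Integrable g (cubeMeasure d) :=
    Integrable.fintype_prod (f := fun _ x => |sin (2 * π * x)| ^ (-(κ / d)))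
      fun _ => integrableOn_abs_sin_rpow_neg (by positivity) (by rw [div_lt_one hd0]; exact hκ)
  have hg0 : 0 ≤ ∫ p, g p ∂(cubeMeasure d) :=
    integral_nonneg fun p => Finset.prod_nonneg fun i _ => rpow_nonneg (abs_nonneg _) _
  refine ⟨A * (∫ p, g p ∂(cubeMeasure d)) + 1, by positivity, fun n hn => ?_⟩
  have hn0 : (0 : ℝ) < n := by exact_mod_cast (by omega : 0 < n)
  -- Where a sine vanishes, the junk value of `0` to a negative power makes `g` zero and useless as
  -- a majorant. Off this null set `B > 0`, which also puts the symbol strictly inside `(-1, 1)`.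
  have hae : ∀ᵐ p ∂(cubeMeasure d), ∀ i, sin (2 * π * p i) ≠ 0 := by
    rw [ae_all_iff]
    intro i
    exact (Measure.tendsto_eval_ae_ae (μ := fun _ : Fin d => volume.restrict (Set.Ioc (0 : ℝ) 1))
      (i := i)).eventually ae_sin_ne_zero
  have hbound : ∀ᵐ p ∂(cubeMeasure d),
      (jacobiPoly d n).eval (symbol d p) ^ 2 ≤ A * (n : ℝ) ^ (-κ) * g p := by
    filter_upwards [hae] with p hp
    have hB0 : 0 < ∏ i, (|sin (2 * π * p i)|) ^ (1 / (d : ℝ)) :=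
      Finset.prod_pos fun i _ => rpow_pos_of_pos (abs_pos.2 (hp i)) _
    have hB := prod_abs_sin_rpow_le hd p
    set B := ∏ i, (|sin (2 * π * p i)|) ^ (1 / (d : ℝ)) with hBdef
    have hgB : g p = (B ^ κ)⁻¹ := by
      rw [hg, hBdef, ← rpow_neg hB0.le, ← finsetProd_rpow _ _ fun i _ => rpow_nonneg (abs_nonneg _) _]
      refine Finset.prod_congr rfl fun i _ => ?_
      rw [← rpow_mul (abs_nonneg _)]
      congr 1
      ring
    have hx : symbol d p ∈ Set.Ioo (-1 : ℝ) 1 := by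
      have := sqrt_pos.1 (hB0.trans_le hB)
      rw [Set.mem_Ioo, ← abs_lt, ← sq_lt_one_iff_abs_lt_one]
      linarith
    have h := jacobiPoly_decay_rpow hd hn hx hκ0.le (by linarith)
    have h' : ((n : ℝ) ^ κ * B ^ κ) * (jacobiPoly d n).eval (symbol d p) ^ 2 ≤ A := by
      refine le_trans ?_ h
      rw [← mul_rpow hn0.le hB0.le]
      gcongr
    rw [hgB, rpow_neg hn0.le, mul_assoc, ← mul_inv, ← div_eq_mul_inv,
      le_div_iff₀ (by positivity), mul_comm]
    exact h'
  calc ∫ p, (jacobiPoly d n).eval (symbol d p) ^ 2 ∂(cubeMeasure d)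
      ≤ ∫ p, A * (n : ℝ) ^ (-κ) * g p ∂(cubeMeasure d) :=
        integral_mono_of_nonneg (Filter.Eventually.of_forall fun p => sq_nonneg _)
          (hgint.const_mul _) hbound
    _ = A * (∫ p, g p ∂(cubeMeasure d)) * (n : ℝ) ^ (-κ) := by
        rw [integral_const_mul]; ring
    _ ≤ (A * (∫ p, g p ∂(cubeMeasure d)) + 1) * (n : ℝ) ^ (-κ) := by
        gcongr
        linarith

end Gossip

/-! ### Passage to logarithmic rates -/

namespace Gossip
open MeasureTheory ProbabilityTheory Filter Topology

/-- The row at `v` is a translate of the coefficients of `P_t` evaluated at `gridStep`, so its norm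
does not depend on `v` and Parseval computes it. -/
lemma integral_sq_jacobiIteration_sub_mean {d : ℕ} (hd : 1 ≤ d) {ν : Measure ℝ}
    [IsProbabilityMeasure ν] (hν : MemLp id 2 ν) {Ω : Type*} [MeasurableSpace Ω] {Pr : Measure Ω}
    [IsProbabilityMeasure Pr] {ξ : (Fin d → ℤ) → Ω → ℝ} (hlaw : ∀ w, HasLaw (ξ w) ν Pr)
    (hindep : iIndepFun ξ Pr) (v : Fin d → ℤ) (t : ℕ) :
    ∫ ω, (jacobiIteration d (gridMatrix d) (fun w => ξ w ω) t v - ∫ y, y ∂ν) ^ 2 ∂Pr =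
      variance id ν * ∫ p, (jacobiPoly d t).eval (symbol d p) ^ 2 ∂(cubeMeasure d) := by
  set q := Polynomial.aeval (gridStep d) (jacobiPoly d t) with hq
  set K : (Fin d → ℤ) →₀ ℝ := q.coeff.mapDomain (Equiv.addLeft v) with hK
  have hKξ : ∀ x : (Fin d → ℤ) → ℝ, jacobiIteration d (gridMatrix d) x t v =
      Finsupp.linearCombination ℝ x K := fun x => by
    rw [jacobiIteration_gridMatrix, shift_apply, hK, Finsupp.linearCombination_mapDomain,
      Finsupp.linearCombination_apply, Finsupp.sum]
    rfl
  have hK1 : Finsupp.linearCombination ℝ (fun _ => (1 : ℝ)) K = 1 := by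
    obtain ⟨L, -, hL1, hL⟩ := exists_row_polyAct (isGossipMatrix_gridMatrix hd)
      (natDegree_jacobiPoly_le d t) (eval_one_jacobiPoly (d := d) (by exact_mod_cast hd) t) v
    rw [← hKξ, jacobiIteration_gridMatrix, ← polyAct_gridMatrix, hL, hL1]
  simp only [hKξ]
  rw [integral_sq_linearCombination_sub_mean hν hlaw hindep K hK1, integral_sq_eval_symbol]
  congr 1
  exact Finsupp.sum_mapDomain_index_inj (h := fun _ k => k ^ 2) (Equiv.addLeft v).injective

lemma tendsto_log_const_mul_rpow_div_log {c : ℝ} (hc : 0 < c) (κ : ℝ) :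
    Tendsto (fun t : ℕ => Real.log (c * (t : ℝ) ^ (-κ)) / Real.log t) atTop (𝓝 (-κ)) := by
  have hlog : Tendsto (fun t : ℕ => Real.log t) atTop atTop :=
    Real.tendsto_log_atTop.comp tendsto_natCast_atTop_atTop
  have h : Tendsto (fun t : ℕ => Real.log c / Real.log t + -κ) atTop (𝓝 (0 + -κ)) :=
    (hlog.const_div_atTop (Real.log c)).add_const _
  rw [zero_add] at h
  refine h.congr' ?_
  filter_upwards [eventually_ge_atTop 2] with t ht
  have ht1 : (1 : ℝ) < t := by exact_mod_cast ht
  have hl : 0 < Real.log t := Real.log_pos ht1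
  rw [Real.log_mul hc.ne' (by positivity), Real.log_rpow (by positivity)]
  field_simp

/-- A sequence that is at least `c (2 t + 1) ^ (-d)` is eventually, on a logarithmic scale, above
a sequence that tends to `-d`. -/
lemma eventually_log_div_log_ge {d : ℕ} {c : ℝ} (hc : 0 < c) {E : ℕ → ℝ}
    (hE : ∀ t : ℕ, c ≤ (2 * (t : ℝ) + 1) ^ d * E t) :
    ∀ᶠ t : ℕ in atTop, Real.log (c / 3 ^ d * (t : ℝ) ^ (-(d : ℝ))) / Real.log t ≤
      Real.log (E t) / Real.log t := by
  filter_upwards [eventually_ge_atTop 2] with t ht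
  have ht1 : (1 : ℝ) < t := by exact_mod_cast ht
  have hl : 0 < Real.log t := Real.log_pos ht1
  have h1 : (2 * (t : ℝ) + 1) ^ d ≤ (3 * t) ^ d := by gcongr; linarith
  -- `Real.log` is monotone only on positive numbers, so positivity of the error must come from the
  -- lower bound itself.
  have hEpos : 0 < E t := by
    by_contra! h
    have : (2 * (t : ℝ) + 1) ^ d * E t ≤ 0 := mul_nonpos_of_nonneg_of_nonpos (by positivity) h
    linarith [hE t]
  gcongr
  rw [Real.rpow_neg (by positivity), Real.rpow_natCast, ← div_eq_mul_inv, div_div, ← mul_pow,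
    div_le_iff₀ (by positivity), mul_comm]
  exact (hE t).trans (by gcongr)

end Gossip

theorem mainTheorem7 (d : ℕ) (hd : 1 ≤ d)
    (ν : MeasureTheory.Measure ℝ) [MeasureTheory.IsProbabilityMeasure ν]
    (hν : MeasureTheory.MemLp id 2 ν) (hvar : ProbabilityTheory.variance id ν ≠ 0)
    {Ω : Type*} [MeasurableSpace Ω] (ℙ : MeasureTheory.Measure Ω)
    [MeasureTheory.IsProbabilityMeasure ℙ]
    (ξ : (Fin d → ℤ) → Ω → ℝ)
    (hlaw : ∀ w, ProbabilityTheory.HasLaw (ξ w) ν ℙ)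
    (hindep : ProbabilityTheory.iIndepFun ξ ℙ)
    (v : Fin d → ℤ) :
    Filter.Tendsto
      (fun t : ℕ =>
        Real.log (∫ ω, (Gossip.jacobiIteration (d : ℝ) (Gossip.gridMatrix d)
          (fun w => ξ w ω) t v - ∫ y, y ∂ν) ^ 2 ∂ℙ) / Real.log t)
      Filter.atTop (nhds (-(d : ℝ))) ∧
    Gossip.IsPolynomialGossip (Gossip.gridGraph d)
      (Gossip.jacobiIteration (d : ℝ) (Gossip.gridMatrix d)) ∧
    ∀ x : ((Fin d → ℤ) → ℝ) → ℕ → (Fin d → ℤ) → ℝ,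
      Gossip.IsPolynomialGossip (Gossip.gridGraph d) x →
      ((-(d : ℝ) : ℝ) : EReal) ≤ Filter.liminf
        (fun t : ℕ =>
          ((Real.log (∫ ω, (x (fun w => ξ w ω) t v - ∫ y, y ∂ν) ^ 2 ∂ℙ) / Real.log t : ℝ) :
            EReal))
        Filter.atTop := by
  have hpoly := Gossip.isPolynomialGossip_jacobiIteration hd
  have hd0 : (0 : ℝ) < d := by exact_mod_cast hd
  have hc : 0 < ProbabilityTheory.variance id ν :=
    (ProbabilityTheory.variance_nonneg id ν).lt_of_ne' hvar
  have hc3 : 0 < ProbabilityTheory.variance id ν / 3 ^ d := by positivity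
  have hlow := Gossip.tendsto_log_const_mul_rpow_div_log hc3 d
  refine ⟨?_, hpoly, fun x hx => ?_⟩
  · have hge := Gossip.eventually_log_div_log_ge hc fun t => hpoly.variance_le hν hlaw hindep v t
    refine tendsto_order.2 ⟨fun a ha => ?_, fun b hb => ?_⟩
    · filter_upwards [hge, hlow.eventually_const_lt ha] with t h1 h2 using h2.trans_le h1
    -- For a target `b > -d`, any positive `κ` with `-b < κ < d` will do; the endpoint `κ = d` is
    -- never needed.
    · obtain ⟨κ, hκ1, hκ2⟩ := exists_between (max_lt hd0 (by linarith : -b < d))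
      obtain ⟨hκ0, hκb⟩ := max_lt_iff.1 hκ1
      obtain ⟨C, hC, hCn⟩ := Gossip.exists_integral_sq_jacobiPoly_le hd hκ0 hκ2
      have hup := Gossip.tendsto_log_const_mul_rpow_div_log (mul_pos hc hC) κ
      filter_upwards [hup.eventually_lt_const (by linarith : -κ < b),
        Filter.eventually_ge_atTop (2 * (d + 1))] with t h1 ht
      refine lt_of_le_of_lt ?_ h1
      have ht1 : (1 : ℝ) < t := by exact_mod_cast (by omega : 1 < t)
      have hl : 0 < Real.log t := Real.log_pos ht1
      have hv := hpoly.variance_le hν hlaw hindep v t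
      have hpos : 0 < ∫ ω, (Gossip.jacobiIteration (d : ℝ) (Gossip.gridMatrix d)
          (fun w => ξ w ω) t v - ∫ y, y ∂ν) ^ 2 ∂ℙ :=
        pos_of_mul_pos_right (hc.trans_le hv) (by positivity)
      gcongr
      rw [Gossip.integral_sq_jacobiIteration_sub_mean hd hν hlaw hindep v t, mul_assoc]
      gcongr
      exact hCn t ht
  · have hge := Gossip.eventually_log_div_log_ge hc fun t => hx.variance_le hν hlaw hindep v t
    -- In `EReal` the comparison of lower limits needs no boundedness, so the error of a competing
    -- method may even grow.
    have hlow' : Filter.Tendsto (fun t : ℕ => ((Real.log (ProbabilityTheory.variance id ν / 3 ^ d *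
        (t : ℝ) ^ (-(d : ℝ))) / Real.log t : ℝ) : EReal)) Filter.atTop
        (nhds ((-(d : ℝ) : ℝ) : EReal)) :=
      (continuous_coe_real_ereal.tendsto _).comp hlow
    rw [← hlow'.liminf_eq]
    exact Filter.liminf_le_liminf (hge.mono fun t ht => EReal.coe_le_coe_iff.2 ht)
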